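/- Let $\mathbb K$ be an algebraically closed field of characteristic $0$, let $V=\mathbb K^{N+1}$ and $\mathbb P^N=\mathbb P(V)$, and write $\hat r\subset V$ for the $2$-dimensional linear subspace corresponding to a line $r\subset\mathbb P^N$. Let $B\subset\mathbb G(1,N)$ be an irreducible closed subvariety of dimension $n\le N-2$ of the Grassmannian of lines of $\mathbb P^N$, and suppose that the union $X\subset\mathbb P^N$ of the lines of $B$ has dimension $n+1$. For $r\in B$ regard the tangent space $T_rB$ as a linear subspace of $T_r\mathbb G(1,N)=\operatorname{Hom}(\hat r,V/\hat r)$. The characteristic map $\chi(r)\colon T_rB\otimes\mathcal O_r\to (V/\hat r)\otimes\mathcal O_r(1)$ sends $\eta$ to $\eta(v)$ at the point $[v]\in r$; the focal locus on $r$ is the closed subscheme of $r\cong\mathbb P^1$ where $\chi(r)$ does not have maximal rank, defined by the maximal minors of $\chi(r)$. The fixed tangent space of $X$ along $r$ is the largest linear subspace of $\mathbb P^N$ contained in the embedded (Zariski) tangent spaces $\mathbb T_xX$ for all $x\in r$, i.e. $\bigcap_{x\in r}\mathbb T_xX$. A property holds for the general $r\in B$ if it holds for all $r$ in some nonempty Zariski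 open subset of $B$. Then, for every integer $k$ with $0\le k\le n$, the following are equivalent: (i) for the general $r\in B$, the focal locus on $r$ is a finite scheme of length $k$; (ii) for the general $r\in B$, the fixed tangent space of $X$ along $r$ is a $\mathbb P^{k+1}$, i.e. it has dimension exactly $k+1$. -/

import Mathlib

open MvPolynomial Filter Module

noncomputable section

/-- The Zariski tangent space at `x` of an affine cone `C ⊆ K^σ`: the common kernel of the
differentials at `x` of all polynomials vanishing on `C`. When `C` is the affine cone over a
projective variety and `x ≠ 0`, its projectivization is the embedded tangent space at `[x]`. -/
def affineTangent {K : Type*} [Field K] {σ : Type*} [Fintype σ]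
    (C : Set (σ → K)) (x : σ → K) : Submodule K (σ → K) where
  carrier := {v | ∀ F ∈ vanishingIdeal K C, ∑ i, eval x (pderiv i F) * v i = 0}
  zero_mem' := by
    intro F _
    simp
  add_mem' := by
    intro v w hv hw F hF
    simp only [Pi.add_apply, mul_add, Finset.sum_add_distrib, hv F hF, hw F hF, add_zero]
  smul_mem' := by
    intro c v hv F hF
    have h : ∑ i, eval x (pderiv i F) * (c • v) i = c * ∑ i, eval x (pderiv i F) * v i := by
      rw [Finset.mul_sum]
      refine Finset.sum_congr rfl fun i _ => ?_
      simp only [Pi.smul_apply, smul_eq_mul]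
      ring
    rw [h, hv F hF, mul_zero]

/-- The projective variety with affine cone `C` has dimension `d`: the coordinate ring of the cone
(that is, the homogeneous coordinate ring of the projective variety) has transcendence degree
`d + 1` over `K`. -/
def HasProjectiveDim (K : Type*) [Field K] {σ : Type*} (C : Set (σ → K)) (d : ℕ) : Prop :=
  Algebra.trdeg K (MvPolynomial σ K ⧸ vanishingIdeal K C) = ((d + 1 : ℕ) : Cardinal)

/-- The lines of `ℙ^N = ℙ(K^(N+1))`, i.e. the points of the Grassmannian `𝔾(1,N) = G(2,N+1)`. -/
structure ProjLine (K : Type*) [Field K] (N : ℕ) where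
  /-- The two-dimensional linear subspace of `K^(N+1)` whose projectivization is the line. -/
  hat : Submodule K (Fin (N + 1) → K)
  finrank_hat : finrank K hat = 2

/-- The Plücker coordinates `p_ij = u_i v_j - u_j v_i` of `u ∧ v`. -/
def plucker {K : Type*} [Field K] {N : ℕ} (u v : Fin (N + 1) → K) :
    Fin (N + 1) × Fin (N + 1) → K :=
  fun ij => u ij.1 * v ij.2 - u ij.2 * v ij.1

namespace ProjLine

variable {K : Type*} [Field K] {N : ℕ}

/-- The Plücker vector of a line, computed in a basis of the corresponding plane of `K^(N+1)`; a
change of basis multiplies it by a nonzero scalar. -/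
def pluckerVec (r : ProjLine K N) (b : Basis (Fin 2) K r.hat) : Fin (N + 1) × Fin (N + 1) → K :=
  plucker (b 0 : Fin (N + 1) → K) (b 1 : Fin (N + 1) → K)

/-- The Zariski topology of the Grassmannian in its Plücker embedding: a base of open sets is given
by the non-vanishing loci of homogeneous polynomials in the Plücker coordinates. -/
instance zariskiTopology : TopologicalSpace (ProjLine K N) :=
  TopologicalSpace.generateFrom
    {U | ∃ (d : ℕ) (F : MvPolynomial (Fin (N + 1) × Fin (N + 1)) K), F.IsHomogeneous d ∧
      U = {r | ∀ b : Basis (Fin 2) K r.hat, eval (r.pluckerVec b) F ≠ 0}}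

/-- The affine cone (without its vertex) over a set of lines in the Plücker embedding. -/
def pluckerCone (B : Set (ProjLine K N)) : Set (Fin (N + 1) × Fin (N + 1) → K) :=
  {w | ∃ r ∈ B, ∃ b : Basis (Fin 2) K r.hat, w = r.pluckerVec b}

/-- The affine cone over the union in `ℙ^N` of the lines of `B`. -/
def unionCone (B : Set (ProjLine K N)) : Set (Fin (N + 1) → K) :=
  {x | ∃ r ∈ B, x ∈ r.hat}

/-- The linear maps `ℓ : r̂ → V = K^(N+1)` such that the first order deformation
`u ↦ u + ε ℓ(u)` of `r̂` is tangent to `B`: for a basis `b` of `r̂`, the derivative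
`ℓ(b₀) ∧ b₁ + b₀ ∧ ℓ(b₁)` of the Plücker vector is tangent to the Plücker cone of `B`. -/
def tangentLifts (B : Set (ProjLine K N)) (r : ProjLine K N) :
    Submodule K (r.hat →ₗ[K] (Fin (N + 1) → K)) where
  carrier := {ℓ | ∀ b : Basis (Fin 2) K r.hat,
    plucker (ℓ (b 0)) (b 1) + plucker (b 0) (ℓ (b 1)) ∈
      affineTangent (pluckerCone B) (r.pluckerVec b)}
  zero_mem' := by
    intro b
    have h : plucker ((0 : r.hat →ₗ[K] (Fin (N + 1) → K)) (b 0)) (b 1) +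
        plucker (b 0) ((0 : r.hat →ₗ[K] (Fin (N + 1) → K)) (b 1)) = 0 := by
      funext ij
      simp [plucker]
    rw [h]
    exact zero_mem _
  add_mem' := by
    intro ℓ m hℓ hm b
    have h : plucker ((ℓ + m) (b 0)) (b 1) + plucker (b 0) ((ℓ + m) (b 1)) =
        (plucker (ℓ (b 0)) (b 1) + plucker (b 0) (ℓ (b 1))) +
        (plucker (m (b 0)) (b 1) + plucker (b 0) (m (b 1))) := by
      funext ij
      simp only [plucker, LinearMap.add_apply, Pi.add_apply]
      ring
    rw [h]
    exact add_mem (hℓ b) (hm b)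
  smul_mem' := by
    intro c ℓ hℓ b
    have h : plucker ((c • ℓ) (b 0)) (b 1) + plucker (b 0) ((c • ℓ) (b 1)) =
        c • (plucker (ℓ (b 0)) (b 1) + plucker (b 0) (ℓ (b 1))) := by
      funext ij
      simp only [plucker, LinearMap.smul_apply, Pi.smul_apply, Pi.add_apply, smul_eq_mul]
      ring
    rw [h]
    exact Submodule.smul_mem _ c (hℓ b)

/-- The tangent space `T_r B`, as a linear subspace of `T_r 𝔾(1,N) = Hom(r̂, V/r̂)`. -/
def tangentSpace (B : Set (ProjLine K N)) (r : ProjLine K N) :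
    Submodule K (r.hat →ₗ[K] ((Fin (N + 1) → K) ⧸ r.hat)) :=
  (tangentLifts B r).map (LinearMap.compRight K r.hat.mkQ)

/-- The square submatrix of size `m` of the characteristic map
`χ(r) : T_r B ⊗ 𝒪_r → V/r̂ ⊗ 𝒪_r(1)`, which sends `η` to `η(v)` at the point `[v]` of `r`,
cut out by tangent vectors `η_j` and linear forms `φ_i` on `V/r̂`. Its entries are linear forms in
the homogeneous coordinates `x₀, x₁` on `r` for which `[v] = [x₀ b₀ + x₁ b₁]`. -/
def charMatrix (r : ProjLine K N) (b : Basis (Fin 2) K r.hat) {m : ℕ}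
    (φ : Fin m → Dual K ((Fin (N + 1) → K) ⧸ r.hat))
    (η : Fin m → (r.hat →ₗ[K] ((Fin (N + 1) → K) ⧸ r.hat))) :
    Matrix (Fin m) (Fin m) (MvPolynomial (Fin 2) K) :=
  Matrix.of fun i j => ∑ a : Fin 2, C (φ i (η j (b a))) * X a

/-- The homogeneous ideal of the focal scheme on `r`, the locus where the rank of `χ(r)` is less
than the minimum of the ranks of its source and target: it is generated by the minors of `χ(r)` of
that order. -/
def focalIdeal (B : Set (ProjLine K N)) (r : ProjLine K N) (b : Basis (Fin 2) K r.hat) :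
    Ideal (MvPolynomial (Fin 2) K) :=
  Ideal.span {P | ∃ (φ : Fin (min (finrank K (tangentSpace B r))
        (finrank K ((Fin (N + 1) → K) ⧸ r.hat))) → Dual K ((Fin (N + 1) → K) ⧸ r.hat))
      (η : Fin (min (finrank K (tangentSpace B r))
        (finrank K ((Fin (N + 1) → K) ⧸ r.hat))) → (r.hat →ₗ[K] ((Fin (N + 1) → K) ⧸ r.hat))),
      (∀ j, η j ∈ tangentSpace B r) ∧ P = (charMatrix r b φ η).det}

/-- The value at `d` of the Hilbert function of `K[x₀, x₁] / I`. -/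
def hilbertFunction (I : Ideal (MvPolynomial (Fin 2) K)) (d : ℕ) : ℕ :=
  finrank K ((homogeneousSubmodule (Fin 2) K d).map (Ideal.Quotient.mkₐ K I).toLinearMap)

/-- The focal locus on `r` is a finite scheme of length `k`: the Hilbert polynomial of its
homogeneous ideal is the constant `k`. -/
def HasFocalLength (B : Set (ProjLine K N)) (r : ProjLine K N) (k : ℕ) : Prop :=
  ∀ b : Basis (Fin 2) K r.hat, ∀ᶠ d in atTop, hilbertFunction (focalIdeal B r b) d = k

/-- The linear subspace of `K^(N+1)` whose projectivization is the largest linear space contained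
in the embedded tangent spaces at all points of `r` to the union of the lines of `B`. -/
def fixedTangent (B : Set (ProjLine K N)) (r : ProjLine K N) : Submodule K (Fin (N + 1) → K) :=
  ⨅ x ∈ {x : Fin (N + 1) → K | x ∈ r.hat ∧ x ≠ 0}, affineTangent (unionCone B) x

/-- A property holds for a general line of the irreducible family `B`: it holds on a nonempty
Zariski open subset of `B`. -/
def ForGeneral (B : Set (ProjLine K N)) (P : ProjLine K N → Prop) : Prop :=
  ∃ U : Set (ProjLine K N), IsOpen U ∧ (U ∩ B).Nonempty ∧ ∀ r ∈ U ∩ B, P r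

end ProjLine

end

noncomputable section

universe u

/-! ### Lengths of subschemes of the projective line. -/

section BinaryForms

variable {K : Type*} [Field K]

/-! Fix a general line `r` and regard `T = T_r B` as a linear system of maps from `r̂` to `V/r̂`. In
characteristic zero the map sweeping out `X` is generically smooth, so at a general `x ∈ r̂` the
tangent space of the cone over `X`, taken modulo `r̂`, is `T(x) = {η(x) | η ∈ T}`
(`exists_sweepDeriv_eq`). Since `dim X = n + 1`, the kernel of the differential of the sweeping map
is generically the line accounted for by scaling, so `η(x) = 0` forces `η = 0`
(`exists_eq_smul_eulerVector`). Hence the fixed tangent space modulo `r̂` is a space `F`, the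
intersection of the `T(x)` over general `x`; `IsFixedSpace` records exactly what is used of this.

The rest is linear algebra on `r`. A map `τ ∈ T` with one value `τ(x₀)` in `F`, `x₀ ≠ 0`, has all
its values in `F` (`mem_mapsInto_of_apply_mem`). So the maps of `T` with values in `F` form a
subspace of dimension `dim F`, and a nonzero map in a complement takes no value in `F` at any
nonzero point. In adapted bases `χ(r)` is block triangular, with a square block of linear forms
describing the maps into `F`. Its determinant is a nonzero form of degree `dim F`; it divides all
maximal minors, and the quotients have no common zero (`exists_minorsIdeal_eq`). The focal scheme
therefore has length `dim F`, two less than the vector space dimension of the fixed tangent space.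
This holds at every line of a nonempty open subset, and irreducibility of `B` makes the two generic
conditions equivalent.

The generic statements are proved over the function field, where tangent vectors are derivations
(`exists_derivation_of_tangent`), and are then spread to an open set by clearing denominators
(`IsGenericCoordinates.specialize`). -/

theorem card_degree_eq (d : ℕ) : Nat.card {m : Fin 2 →₀ ℕ | m.degree = d} = d + 1 := by
  have h : {m : Fin 2 →₀ ℕ | m.degree = d} =
      (Finset.univ.finsuppAntidiag d : Finset (Fin 2 →₀ ℕ)) := by
    ext m
    simp [Finset.mem_finsuppAntidiag, Finsupp.degree_eq_sum]
  rw [h, Nat.card_coe_set_eq, Set.ncard_coe_finset, Finset.card_finsuppAntidiag_nat_eq_choose,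
    Finset.card_univ, Fintype.card_fin, show 2 + d - 1 = d + 1 by omega, Nat.choose_succ_self_right]

theorem finrank_homogeneousSubmodule_two (d : ℕ) :
    finrank K (homogeneousSubmodule (Fin 2) K d) = d + 1 := by
  rw [homogeneousSubmodule_eq_finsupp_supported,
    (AddMonoidAlgebra.supportedEquivFinsupp (R := K) (S := K)
      {m : Fin 2 →₀ ℕ | m.degree = d}).finrank_eq]
  have : Finite {m : Fin 2 →₀ ℕ | m.degree = d} :=
    Nat.finite_of_card_ne_zero (by rw [card_degree_eq]; omega)
  have : Fintype {m : Fin 2 →₀ ℕ | m.degree = d} := Fintype.ofFinite _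
  rw [Module.finrank_finsupp_self, ← Nat.card_eq_fintype_card, card_degree_eq]

instance (d : ℕ) : FiniteDimensional K (homogeneousSubmodule (Fin 2) K d) :=
  FiniteDimensional.of_finrank_pos (by rw [finrank_homogeneousSubmodule_two]; omega)

/-- An ideal of binary forms without common zeros contains all forms of large degree. -/
theorem exists_homogeneousSubmodule_le [IsAlgClosed K] (J : Ideal (MvPolynomial (Fin 2) K))
    (hJ : ∀ x : Fin 2 → K, x ≠ 0 → ∃ q ∈ J, eval x q ≠ 0) :
    ∃ d₀, ∀ d, d₀ ≤ d → ∀ p : MvPolynomial (Fin 2) K, p.IsHomogeneous d → p ∈ J := by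
  -- Nullstellensatz: the only possible zero of `J` is the origin, where both variables vanish.
  have hX : ∀ i : Fin 2, (X i : MvPolynomial (Fin 2) K) ∈ J.radical := by
    intro i
    rw [← vanishingIdeal_zeroLocus_eq_radical (K := K), mem_vanishingIdeal_iff]
    intro x hx
    by_cases h0 : x = 0
    · simp [h0]
    · obtain ⟨q, hq, hne⟩ := hJ x h0
      exact absurd (by simpa [aeval_eq_eval] using hx q hq) hne
  obtain ⟨a, ha⟩ := hX 0
  obtain ⟨c, hc⟩ := hX 1
  -- A monomial of degree at least `a + c` is divisible by `X 0 ^ a` or by `X 1 ^ c`.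
  refine ⟨a + c, fun d hd p hp => ?_⟩
  rw [p.as_sum]
  refine J.sum_mem fun m hm => ?_
  have hdeg : m 0 + m 1 = d := by
    have := hp (mem_support_iff.mp hm)
    simpa [Finsupp.weight_apply, Finsupp.sum_fintype] using this
  have hmon : monomial m (coeff m p) = C (coeff m p) * (X 0 ^ m 0 * X 1 ^ m 1) := by
    rw [monomial_eq, Finsupp.prod_fintype _ _ (by simp)]
    simp
  rw [hmon]
  apply J.mul_mem_left
  rcases le_or_gt a (m 0) with h | h
  · exact J.mul_mem_right _ (J.pow_mem_of_pow_mem ha h)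
  · exact J.mul_mem_left _ (J.pow_mem_of_pow_mem hc (by omega))

theorem homogeneousComponent_mul_of_isHomogeneous {σ : Type*} {P : MvPolynomial σ K} {κ : ℕ}
    (hP : P.IsHomogeneous κ) (h : MvPolynomial σ K) (d : ℕ) :
    homogeneousComponent (κ + d) (P * h) = P * homogeneousComponent d h := by
  conv_lhs => rw [← sum_homogeneousComponent h, Finset.mul_sum, map_sum]
  have : ∀ i, homogeneousComponent (κ + d) (P * homogeneousComponent i h) =
      if d = i then P * homogeneousComponent i h else 0 := by
    intro i
    rw [homogeneousComponent_of_mem (hP.mul (homogeneousComponent_isHomogeneous i h))]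
    simp
  rw [Finset.sum_congr rfl fun i _ => this i, Finset.sum_ite_eq]
  split_ifs with hi
  · rfl
  · rw [homogeneousComponent_eq_zero, mul_zero]
    simpa [Nat.lt_succ_iff] using hi

/-- Rank-nullity for the quotient map on forms of degree `d`; the additive form avoids truncated
subtraction. -/
theorem finrank_map_mkₐ_add (I : Ideal (MvPolynomial (Fin 2) K)) (d : ℕ) :
    ProjLine.hilbertFunction I d +
      finrank K (homogeneousSubmodule (Fin 2) K d ⊓ I.restrictScalars K : Submodule K _) =
        d + 1 := by
  set f := (Ideal.Quotient.mkₐ K I).toLinearMap.domRestrict (homogeneousSubmodule (Fin 2) K d)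
  have h := f.finrank_range_add_finrank_ker
  rw [finrank_homogeneousSubmodule_two] at h
  rw [ProjLine.hilbertFunction, ← h]
  congr 1
  · rw [LinearMap.range_domRestrict]
  · have : (homogeneousSubmodule (Fin 2) K d ⊓ I.restrictScalars K : Submodule K _) =
        (LinearMap.ker f).map (homogeneousSubmodule (Fin 2) K d).subtype := by
      ext p
      simp only [Submodule.mem_inf, Submodule.restrictScalars_mem, Submodule.mem_map,
        LinearMap.mem_ker, Subtype.exists, Submodule.subtype_apply]
      constructor
      · rintro ⟨h1, h2⟩
        exact ⟨p, h1, Ideal.Quotient.eq_zero_iff_mem.mpr h2, rfl⟩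
      · rintro ⟨q, h1, h2, rfl⟩
        exact ⟨h1, Ideal.Quotient.eq_zero_iff_mem.mp h2⟩
    rw [this]
    exact LinearEquiv.finrank_eq (Submodule.equivMapOfInjective _
      (Submodule.injective_subtype _) _).symm

/-- The subscheme of the projective line cut out by a form of degree `κ` times an ideal without
zeros has length `κ`. -/
theorem hilbertFunction_eventually_eq [IsAlgClosed K] {P : MvPolynomial (Fin 2) K} {κ : ℕ}
    (hP : P.IsHomogeneous κ) (hP0 : P ≠ 0) (J : Ideal (MvPolynomial (Fin 2) K))
    (hJ : ∀ x : Fin 2 → K, x ≠ 0 → ∃ q ∈ J, eval x q ≠ 0) :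
    ∀ᶠ d in atTop, ProjLine.hilbertFunction (Ideal.span {P} * J) d = κ := by
  obtain ⟨d₀, hd₀⟩ := exists_homogeneousSubmodule_le J hJ
  filter_upwards [eventually_ge_atTop (κ + d₀)] with d hd
  obtain ⟨e, rfl⟩ : ∃ e, d = κ + e := ⟨d - κ, by omega⟩
  have h := finrank_map_mkₐ_add (Ideal.span {P} * J) (κ + e)
  -- In this degree `J` imposes no condition on the cofactor of `P`. The cofactor need not be
  -- homogeneous, but its component of degree `e` gives the same product.
  have hmap : (homogeneousSubmodule (Fin 2) K (κ + e) ⊓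
      (Ideal.span {P} * J).restrictScalars K : Submodule K _) =
        (homogeneousSubmodule (Fin 2) K e).map (LinearMap.mulLeft K P) := by
    ext p
    simp only [Submodule.mem_inf, Submodule.restrictScalars_mem, Submodule.mem_map,
      Ideal.mem_span_singleton_mul, mem_homogeneousSubmodule, LinearMap.mulLeft_apply]
    constructor
    · rintro ⟨hp, q, -, rfl⟩
      refine ⟨homogeneousComponent e q, homogeneousComponent_isHomogeneous e q, ?_⟩
      rw [← homogeneousComponent_mul_of_isHomogeneous hP, homogeneousComponent_of_mem hp,
        if_pos rfl]
    · rintro ⟨q, hq, rfl⟩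
      exact ⟨hP.mul hq, q, hd₀ e (by omega) q hq, rfl⟩
  rw [hmap, ← LinearEquiv.finrank_eq (Submodule.equivMapOfInjective (LinearMap.mulLeft K P)
    (mul_right_injective₀ hP0) _), finrank_homogeneousSubmodule_two] at h
  omega

end BinaryForms

/-! ### Linear systems of maps with a fixed space. -/

section Pencils

variable {K : Type*} [Field K] {H W : Type*} [AddCommGroup H] [Module K H]
  [AddCommGroup W] [Module K W]

/-- A generic set `G` for a linear system `T` of maps `H → W` with fixed space `F`: the maps in `T`
are determined by their value at any point of `G`, and `F` is the intersection of the spaces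
`{τ x | τ ∈ T}` for `x` in `G`, or in `G` minus a line. -/
structure IsFixedSpace (T : Submodule K (H →ₗ[K] W)) (F : Submodule K W) (G : Set H) : Prop where
  exists_eq : ∀ x ∈ G, ∀ y ∈ F, ∃ τ ∈ T, τ x = y
  mem : ∀ x₁ : H, x₁ ≠ 0 → ∀ y : W,
    (∀ x ∈ G, x ∉ Submodule.span K {x₁} → ∃ τ ∈ T, τ x = y) → y ∈ F
  eq_zero : ∀ x ∈ G, ∀ τ ∈ T, τ x = 0 → τ = 0

variable {T : Submodule K (H →ₗ[K] W)} {F : Submodule K W} {G : Set H}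

/-- The maps in `T` with values in `F`. -/
def mapsInto (T : Submodule K (H →ₗ[K] W)) (F : Submodule K W) : Submodule K (H →ₗ[K] W) where
  carrier := {τ | τ ∈ T ∧ ∀ x, τ x ∈ F}
  zero_mem' := ⟨T.zero_mem, fun _ => F.zero_mem⟩
  add_mem' h h' := ⟨T.add_mem h.1 h'.1, fun x => F.add_mem (h.2 x) (h'.2 x)⟩
  smul_mem' c _ h := ⟨T.smul_mem c h.1, fun x => F.smul_mem c (h.2 x)⟩

theorem exists_eq_smul_add_smul (hH : finrank K H = 2) {x₀ x₁ : H} (h0 : x₀ ≠ 0)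
    (h1 : x₁ ∉ Submodule.span K {x₀}) (x : H) : ∃ a b : K, x = a • x₀ + b • x₁ := by
  have hli : LinearIndependent K ![x₀, x₁] := by
    rw [LinearIndependent.pair_iff' h0]
    intro a ha
    exact h1 (Submodule.mem_span_singleton.mpr ⟨a, ha⟩)
  have := FiniteDimensional.of_finrank_pos (K := K) (V := H) (by omega)
  have htop := hli.span_eq_top_of_card_eq_finrank' (by simp [hH])
  have hx : x ∈ Submodule.span K (Set.range ![x₀, x₁]) := htop ▸ Submodule.mem_top
  rw [Matrix.range_cons, Matrix.range_cons, Matrix.range_empty, Set.union_empty,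
    Set.singleton_union, Submodule.mem_span_pair] at hx
  obtain ⟨a, b, h⟩ := hx
  exact ⟨a, b, h.symm⟩

namespace IsFixedSpace

/-- A map of the system with one value in the fixed space has all its values there. -/
theorem mem_mapsInto_of_apply_mem (h : IsFixedSpace T F G) (hH : finrank K H = 2)
    {τ : H →ₗ[K] W} (hτ : τ ∈ T) {x₀ : H} (h0 : x₀ ≠ 0) (hF : τ x₀ ∈ F) : τ ∈ mapsInto T F := by
  refine ⟨hτ, fun x₁ => ?_⟩
  by_cases h1 : x₁ ∈ Submodule.span K {x₀}
  · obtain ⟨a, rfl⟩ := Submodule.mem_span_singleton.mp h1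
    rw [map_smul]
    exact F.smul_mem a hF
  -- Off the line of `x₀`, write `x = a x₀ + b x₁` with `b ≠ 0`. If `σ x = τ x₀`, then `(τ - a σ) x
  -- = b τ x₁`, so `τ x₁` is a value of the system at `x`.
  refine h.mem x₀ h0 _ fun x hx hx0 => ?_
  obtain ⟨a, b, rfl⟩ := exists_eq_smul_add_smul hH h0 h1 x
  have hb : b ≠ 0 := by
    rintro rfl
    exact hx0 (Submodule.mem_span_singleton.mpr ⟨a, by simp⟩)
  obtain ⟨σ, hσ, hσx⟩ := h.exists_eq _ hx _ hF
  refine ⟨b⁻¹ • (τ - a • σ), T.smul_mem _ (T.sub_mem hτ (T.smul_mem a hσ)), ?_⟩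
  rw [LinearMap.smul_apply, LinearMap.sub_apply, LinearMap.smul_apply, hσx, map_add, map_smul,
    map_smul, add_sub_cancel_left, smul_smul, inv_mul_cancel₀ hb, one_smul]

/-- Evaluation at `x₁` is an isomorphism: it is injective on all of `T`, and a map hitting a vector
of `F` at `x₁` has all its values in `F`. -/
theorem finrank_mapsInto (h : IsFixedSpace T F G) (hH : finrank K H = 2) {x₁ : H} (hx : x₁ ∈ G)
    (h0 : x₁ ≠ 0) : finrank K (mapsInto T F) = finrank K F := by
  let f : mapsInto T F →ₗ[K] F :=
    { toFun := fun τ => ⟨τ.1 x₁, τ.2.2 x₁⟩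
      map_add' := fun _ _ => rfl
      map_smul' := fun _ _ => rfl }
  refine (LinearEquiv.ofBijective f ⟨?_, ?_⟩).finrank_eq
  · rw [injective_iff_map_eq_zero]
    intro τ hτ
    exact Subtype.ext (h.eq_zero x₁ hx τ.1 τ.2.1 (congrArg Subtype.val hτ))
  · rintro ⟨y, hy⟩
    obtain ⟨τ, hτ, rfl⟩ := h.exists_eq x₁ hx y hy
    exact ⟨⟨τ, h.mem_mapsInto_of_apply_mem hH hτ h0 hy⟩, rfl⟩

end IsFixedSpace

/-- The linear form `s ↦ φ (τ (s₀ b₀ + s₁ b₁))`. -/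
def pencilForm (b : Fin 2 → H) (φ : Dual K W) (τ : H →ₗ[K] W) : MvPolynomial (Fin 2) K :=
  ∑ a : Fin 2, C (φ (τ (b a))) * X a

theorem eval_pencilForm (b : Fin 2 → H) (φ : Dual K W) (τ : H →ₗ[K] W) (s : Fin 2 → K) :
    eval s (pencilForm b φ τ) = φ (τ (∑ a, s a • b a)) := by
  simp [pencilForm, mul_comm]

theorem isHomogeneous_pencilForm (b : Fin 2 → H) (φ : Dual K W) (τ : H →ₗ[K] W) :
    (pencilForm b φ τ).IsHomogeneous 1 :=
  IsHomogeneous.sum _ _ _ fun a _ => isHomogeneous_C_mul_X _ a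

theorem pencilForm_sum_smul {ι : Type*} (s : Finset ι) (b : Fin 2 → H) (φ : Dual K W) (c : ι → K)
    (τ : ι → (H →ₗ[K] W)) :
    pencilForm b φ (∑ i ∈ s, c i • τ i) = ∑ i ∈ s, pencilForm b φ (τ i) * C (c i) := by
  simp only [pencilForm, LinearMap.sum_apply, LinearMap.smul_apply, map_sum, map_smul,
    smul_eq_mul, map_mul, Finset.sum_mul]
  rw [Finset.sum_comm]
  refine Finset.sum_congr rfl fun i _ => Finset.sum_congr rfl fun a _ => by ring

theorem isHomogeneous_det {σ ι : Type*} [Fintype ι] [DecidableEq ι]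
    {M : Matrix ι ι (MvPolynomial σ K)} (hM : ∀ i j, (M i j).IsHomogeneous 1) :
    M.det.IsHomogeneous (Fintype.card ι) := by
  rw [Matrix.det_apply]
  refine IsHomogeneous.sum _ _ _ fun p _ => ?_
  have h : (∏ i, M (p i) i).IsHomogeneous (Fintype.card ι) := by
    simpa using IsHomogeneous.prod Finset.univ (fun i => M (p i) i) (fun _ => 1)
      fun i _ => hM _ _
  rcases Int.units_eq_one_or (Equiv.Perm.sign p) with hs | hs
  · simpa [hs] using h
  · simpa [hs] using h.neg

theorem exists_dual_apply_eq_ite {ι : Type*} [Fintype ι] [DecidableEq ι] {v : ι → W}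
    (hv : LinearIndependent K v) :
    ∃ φ : ι → Dual K W, ∀ i j, φ i (v j) = if i = j then 1 else 0 := by
  obtain ⟨g, hg⟩ := LinearMap.exists_leftInverse_of_injective (Fintype.linearCombination K v)
    (LinearMap.ker_eq_bot.mpr (hv.fintypeLinearCombination_injective))
  refine ⟨fun i => (LinearMap.proj i).comp g, fun i j => ?_⟩
  have := LinearMap.congr_fun hg (Pi.single j 1)
  rw [LinearMap.comp_apply, Fintype.linearCombination_apply_single, one_smul] at this
  rw [LinearMap.comp_apply, this]
  simp [Pi.single_apply]

/-- The ideal of maximal minors of a pencil of linear maps. -/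
def minorsIdeal (T : Submodule K (H →ₗ[K] W)) (b : Fin 2 → H) (m : ℕ) :
    Ideal (MvPolynomial (Fin 2) K) :=
  Ideal.span {P | ∃ (φ : Fin m → Dual K W) (η : Fin m → (H →ₗ[K] W)),
    (∀ j, η j ∈ T) ∧ P = (Matrix.of fun i j => pencilForm b (φ i) (η j)).det}

/-- A basis of `F` and a basis of `T` whose first part is a basis of the maps with values in `F`,
indexed by a common `Fin m`. -/
theorem exists_adapted_basis [FiniteDimensional K W] [FiniteDimensional K H]
    (T : Submodule K (H →ₗ[K] W)) (F : Submodule K W)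
    (hF : finrank K (mapsInto T F) = finrank K F) :
    ∃ (q : ℕ) (_ : Fin (finrank K T) ≃ Fin (finrank K F) ⊕ Fin q)
      (t₁ : Basis (Fin (finrank K F)) K (mapsInto T F))
      (t : Fin (finrank K F) ⊕ Fin q → (H →ₗ[K] W)),
      LinearIndependent K t ∧ Submodule.span K (Set.range t) = T ∧ ∀ l, t (Sum.inl l) = t₁ l := by
  have hle : mapsInto T F ≤ T := fun _ h => h.1
  let S : Submodule K T := (mapsInto T F).submoduleOf T
  let e : S ≃ₗ[K] mapsInto T F := Submodule.submoduleOfEquivOfLe hle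
  obtain ⟨S', hS'⟩ := S.exists_isCompl
  let t₁ : Basis (Fin (finrank K F)) K (mapsInto T F) := finBasisOfFinrankEq K _ hF
  have : Module.Free K S' := Module.Free.of_divisionRing K S'
  let t₂ := finBasis K S'
  let t : Basis (Fin (finrank K F) ⊕ Fin (finrank K S')) K T :=
    ((t₁.map e.symm).prod t₂).map (Submodule.prodEquivOfIsCompl S S' hS')
  refine ⟨finrank K S', (finBasis K T).indexEquiv t, t₁, fun i => (t i : H →ₗ[K] W),
    t.linearIndependent.map' T.subtype (Submodule.ker_subtype T), ?_, fun l => ?_⟩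
  · have := congrArg (Submodule.map T.subtype) t.span_eq
    rw [Submodule.map_span, Submodule.map_top, Submodule.range_subtype, ← Set.range_comp] at this
    exact this
  · simp [t, e, Submodule.submoduleOfEquivOfLe]

end Pencils

/-! ### Factorization of the maximal minors. -/

section Pencils

variable {K : Type*} [Field K] {H W : Type*} [AddCommGroup H] [Module K H]
  [AddCommGroup W] [Module K W] {T : Submodule K (H →ₗ[K] W)} {F : Submodule K W} {G : Set H}

/-- The maximal minors of a pencil are the multiples by one form, of degree the dimension of the
fixed space, of forms without common zeros. -/
theorem IsFixedSpace.exists_minorsIdeal_eq [FiniteDimensional K W] (h : IsFixedSpace T F G)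
    (hH : finrank K H = 2) {x₁ : H} (hx : x₁ ∈ G) (h0 : x₁ ≠ 0) (b : Basis (Fin 2) K H) :
    ∃ (P : MvPolynomial (Fin 2) K) (J : Ideal (MvPolynomial (Fin 2) K)),
      P.IsHomogeneous (finrank K F) ∧ P ≠ 0 ∧ (∀ x : Fin 2 → K, x ≠ 0 → ∃ q ∈ J, eval x q ≠ 0) ∧
        minorsIdeal T b (finrank K T) = Ideal.span {P} * J := by
  have := FiniteDimensional.of_finrank_pos (K := K) (V := H) (by omega)
  obtain ⟨q, e, t₁, t, hli, hspan, ht₁⟩ := exists_adapted_basis T F (h.finrank_mapsInto hH hx h0)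
  have htT : ∀ i, t i ∈ T := fun i => hspan.le (Submodule.subset_span ⟨i, rfl⟩)
  let f := finBasis K F
  let g : Fin (finrank K F) → (H →ₗ[K] F) := fun j =>
    (t (Sum.inl j)).codRestrict F fun x => by rw [ht₁]; exact (t₁ j).2.2 x
  let Pm : Matrix (Fin (finrank K F)) (Fin (finrank K F)) (MvPolynomial (Fin 2) K) :=
    Matrix.of fun l j => pencilForm b (f.coord l) (g j)
  -- The columns of `t` with values in `F` are constant combinations of the rows of `Pm`, with the
  -- coefficients `φ i (f l)`. Splitting them off leaves constant columns and the columns of the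
  -- complement.
  let Q : (Fin (finrank K T) → Dual K W) →
      Matrix (Fin (finrank K T)) (Fin (finrank K F) ⊕ Fin q) (MvPolynomial (Fin 2) K) := fun φ =>
    Matrix.of fun i => Sum.elim (fun l => C (φ i (f l))) fun j => pencilForm b (φ i) (t (Sum.inr j))
  let D : Matrix (Fin (finrank K F) ⊕ Fin q) (Fin (finrank K F) ⊕ Fin q)
    (MvPolynomial (Fin 2) K) := Matrix.fromBlocks Pm 0 0 1
  have hg : ∀ (φ : Dual K W) j, pencilForm b φ (t (Sum.inl j)) = ∑ l, C (φ (f l)) * Pm l j := by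
    intro φ j
    have key : ∀ a, φ (t (Sum.inl j) (b a)) = ∑ l, φ (f l) * f.coord l (g j (b a)) := by
      intro a
      have h1 : t (Sum.inl j) (b a) = ((g j (b a) : F) : W) := rfl
      have h2 : φ ((∑ l, f.repr (g j (b a)) l • f l : F) : W) =
          ∑ l, φ (f l) * f.repr (g j (b a)) l := by
        rw [Submodule.coe_sum, map_sum]
        exact Finset.sum_congr rfl fun l _ => by
          rw [Submodule.coe_smul, map_smul, smul_eq_mul, mul_comm]
      rw [f.sum_repr] at h2
      rw [h1, h2]
      rfl
    simp only [pencilForm, Pm, Matrix.of_apply, key, map_sum, map_mul, Finset.sum_mul,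
      Finset.mul_sum, mul_assoc]
    rw [Finset.sum_comm]
  have hfac : ∀ φ : Fin (finrank K T) → Dual K W,
      (Matrix.of fun i j => pencilForm b (φ i) (t j)) = Q φ * D := by
    intro φ
    ext1 i j
    rw [Matrix.mul_apply, Fintype.sum_sum_type]
    rcases j with j | j
    · simp [Q, D, hg]
    · simp [Q, D, Matrix.one_apply]
  -- An arbitrary tuple in `T` differs from the adapted basis by a constant matrix `M`, which
  -- contributes only a scalar. The equivalence `e` squares the matrices so that determinants
  -- multiply.
  have hdet : ∀ (φ : Fin (finrank K T) → Dual K W)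
      (M : Matrix (Fin (finrank K F) ⊕ Fin q) (Fin (finrank K T)) K),
      (Matrix.of fun i j => pencilForm b (φ i) (∑ k, M k j • t k)).det =
        Pm.det * (((Q φ).submatrix id e).det * C (M.submatrix e id).det) := by
    intro φ M
    have h1 : (Matrix.of fun i j => pencilForm b (φ i) (∑ k, M k j • t k)) =
        (Q φ).submatrix id e * D.submatrix e e * (M.map C).submatrix e id := by
      rw [Matrix.submatrix_mul_equiv, ← hfac, Matrix.submatrix_mul_equiv]
      ext1 i j
      simp only [Matrix.mul_apply, Matrix.of_apply, pencilForm_sum_smul, Matrix.submatrix_apply,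
        Matrix.map_apply, id]
    have h2 : ((M.map C).submatrix e id).det =
        (C (M.submatrix e id).det : MvPolynomial (Fin 2) K) := by
      rw [RingHom.map_det]
      rfl
    rw [h1, Matrix.det_mul, Matrix.det_mul, Matrix.det_submatrix_equiv_self,
      Matrix.det_fromBlocks_zero₂₁, Matrix.det_one, h2]
    ring
  refine ⟨Pm.det, Ideal.span (Set.range fun φ => ((Q φ).submatrix id e).det), ?_, ?_, ?_, ?_⟩
  · have : Pm.det.IsHomogeneous (Fintype.card (Fin (finrank K F))) :=
      isHomogeneous_det fun l j => isHomogeneous_pencilForm _ _ _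
    rwa [Fintype.card_fin] at this
  -- If the determinant were zero, evaluating at `x₁` would give a nontrivial combination of the
  -- first basis vectors vanishing at `x₁`, hence zero.
  · intro hP
    have hev : (Pm.map (eval (b.repr x₁))).det = 0 := by
      rw [← RingHom.mapMatrix_apply, ← RingHom.map_det, hP, map_zero]
    obtain ⟨v, hv0, hv⟩ := Matrix.exists_mulVec_eq_zero_iff.mpr hev
    have hgv : ∑ j, v j • g j x₁ = 0 := by
      apply f.ext_elem
      intro l
      have := congrFun hv l
      simp only [Matrix.mulVec, dotProduct, Matrix.map_apply, Pm, Matrix.of_apply,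
        eval_pencilForm, b.sum_repr, Pi.zero_apply] at this
      simpa [mul_comm] using this
    have hτ : ∑ j, v j • t (Sum.inl j) = 0 := by
      apply h.eq_zero x₁ hx
      · exact T.sum_mem fun j _ => T.smul_mem _ (by rw [ht₁]; exact (t₁ j).2.1)
      · have := congrArg Subtype.val hgv
        simpa [g] using this
    have hli' := hli.comp Sum.inl Sum.inl_injective
    exact hv0 (funext (Fintype.linearIndependent_iff.mp hli' v hτ))
  · intro x hx0
    set y : H := ∑ a, x a • b a with hy
    have hy0 : y ≠ 0 := by
      intro h0
      exact hx0 (funext (Fintype.linearIndependent_iff.mp b.linearIndependent x h0))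
    -- A relation says that a combination `τ` of the complementary maps has its value at `y` in `F`.
    -- Then `τ` has all its values in `F`, so it is also a combination of the first basis vectors,
    -- and independence of `t` kills it.
    have hcols : LinearIndependent K
        (Sum.elim (fun l => (f l : W)) (fun j => t (Sum.inr j) y) : _ ⊕ Fin q → W) := by
      rw [Fintype.linearIndependent_iff]
      intro c hc
      rw [Fintype.sum_sum_type] at hc
      simp only [Sum.elim_inl, Sum.elim_inr] at hc
      set τ := ∑ j, c (Sum.inr j) • t (Sum.inr j) with hτ
      have hfF : ∑ l, c (Sum.inl l) • (f l : W) ∈ F :=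
        F.sum_mem fun l _ => F.smul_mem _ (f l).2
      have hτy : τ y = ∑ j, c (Sum.inr j) • t (Sum.inr j) y := by simp [hτ]
      have hτF : τ y ∈ F := by
        rw [hτy, ← neg_eq_of_add_eq_zero_right hc]
        exact F.neg_mem hfF
      have hτT : τ ∈ T := T.sum_mem fun j _ => T.smul_mem _ (htT _)
      have hmem := h.mem_mapsInto_of_apply_mem hH hτT hy0 hτF
      have hrep := t₁.sum_repr ⟨τ, hmem⟩
      have hrep' : ∑ j, t₁.repr ⟨τ, hmem⟩ j • t (Sum.inl j) = τ := by
        have := congrArg Subtype.val hrep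
        rw [Submodule.coe_sum] at this
        simp only [ht₁]
        exact this
      have hrel : ∑ i, Sum.elim (fun j => -t₁.repr ⟨τ, hmem⟩ j) (fun j => c (Sum.inr j)) i • t i
          = 0 := by
        rw [Fintype.sum_sum_type]
        simp only [Sum.elim_inl, Sum.elim_inr, neg_smul, Finset.sum_neg_distrib, hrep', ← hτ]
        exact neg_add_cancel τ
      have hz := Fintype.linearIndependent_iff.mp hli _ hrel
      have hcr : ∀ j, c (Sum.inr j) = 0 := fun j => hz (Sum.inr j)
      have hcl : ∑ l, c (Sum.inl l) • f l = 0 := by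
        apply Subtype.ext
        simpa [hcr] using hc
      rintro (l | j)
      · exact Fintype.linearIndependent_iff.mp f.linearIndependent _ hcl l
      · exact hcr j
    obtain ⟨φ, hφ⟩ := exists_dual_apply_eq_ite hcols
    refine ⟨_, Ideal.subset_span ⟨fun i => φ (e i), rfl⟩, ?_⟩
    -- Functionals dual to the columns turn the evaluated matrix into the identity.
    have h1 : ((Q fun i => φ (e i)).submatrix id e).map (eval x) = 1 := by
      ext1 i j
      have h2 := hφ (e i) (e j)
      simp only [e.injective.eq_iff] at h2
      rw [Matrix.one_apply, ← h2]
      change eval x (Q (fun i => φ (e i)) i (e j)) = _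
      rcases e j with l | l
      · simp [Q]
      · simp [Q, eval_pencilForm, hy]
    rw [RingHom.map_det, RingHom.mapMatrix_apply, h1, Matrix.det_one]
    exact one_ne_zero
  · apply le_antisymm
    · rw [minorsIdeal, Ideal.span_le]
      rintro _ ⟨φ, η, hη, rfl⟩
      have : ∀ j, ∃ c : Fin (finrank K F) ⊕ Fin q → K, ∑ k, c k • t k = η j := fun j =>
        (Submodule.mem_span_range_iff_exists_fun K).mp (hspan.ge (hη j))
      choose M hM using this
      simp only [← hM]
      rw [hdet φ fun k j => M j k]
      exact Ideal.mul_mem_mul (Ideal.mem_span_singleton_self _)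
        (Ideal.mul_mem_right _ _ (Ideal.subset_span ⟨φ, rfl⟩))
    -- Taking the adapted basis itself as tangent vectors makes `M` the matrix of the reindexing
    -- `e`, so the scalar is `1`.
    · rw [Ideal.span_mul_span', Ideal.span_le]
      rintro _ ⟨_, rfl, _, ⟨φ, rfl⟩, rfl⟩
      refine Ideal.subset_span ⟨φ, fun j => t (e j),
        fun j => htT _, ?_⟩
      have h1 : (fun i j => pencilForm b (φ i) (t (e j))) = fun i j => pencilForm b (φ i)
          (∑ k, (Matrix.of fun k j => if k = e j then 1 else 0 : Matrix _ _ K) k j • t k) := by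
        funext i j
        simp
      have h2 : ((Matrix.of fun k j => if k = e j then 1 else 0 : Matrix _ _ K).submatrix e
          (id : Fin (finrank K T) → _)) = 1 := by
        ext1 i j
        simp [Matrix.one_apply]
      rw [h1, hdet, h2]
      simp

/-- Evaluation at a generic point embeds `T` in `W`. Hence the maximal minors have the order of the
source of the characteristic map. -/
theorem IsFixedSpace.finrank_le [FiniteDimensional K W] (h : IsFixedSpace T F G) {x₁ : H}
    (hx : x₁ ∈ G) : finrank K T ≤ finrank K W :=
  LinearMap.finrank_le_finrank_of_injective
    (f := (LinearMap.applyₗ x₁ : (H →ₗ[K] W) →ₗ[K] W).domRestrict T) <| by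
    rw [injective_iff_map_eq_zero]
    intro τ hτ
    exact Subtype.ext (h.eq_zero x₁ hx τ.1 τ.2 hτ)

end Pencils

/-- The focal length is the dimension of the fixed space of the characteristic map. -/
theorem ProjLine.hasFocalLength_iff {K : Type*} [Field K] [IsAlgClosed K] {N : ℕ}
    {B : Set (ProjLine K N)} {r : ProjLine K N}
    {F : Submodule K ((Fin (N + 1) → K) ⧸ r.hat)} {G : Set r.hat}
    (h : IsFixedSpace (tangentSpace B r) F G) {x₁ : r.hat} (hx : x₁ ∈ G) (h0 : x₁ ≠ 0) (k : ℕ) :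
    HasFocalLength B r k ↔ finrank K F = k := by
  have hI : ∀ b : Basis (Fin 2) K r.hat,
      ∀ᶠ d in atTop, hilbertFunction (focalIdeal B r b) d = finrank K F := by
    intro b
    obtain ⟨P, J, hP, hP0, hJ, heq⟩ := h.exists_minorsIdeal_eq r.finrank_hat hx h0 b
    have : focalIdeal B r b = minorsIdeal (tangentSpace B r) b (finrank K (tangentSpace B r)) := by
      rw [focalIdeal, min_eq_left (h.finrank_le hx)]
      rfl
    rw [this, heq]
    exact hilbertFunction_eventually_eq hP hP0 J hJ
  constructor
  · intro hk
    have b : Basis (Fin 2) K r.hat := finBasisOfFinrankEq K _ r.finrank_hat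
    obtain ⟨d, hd, hd'⟩ := ((hI b).and (hk b)).exists
    exact hd.symm.trans hd'
  · rintro rfl
    exact hI

/-! ### Tangent vectors and derivations in characteristic zero. -/

section Derivations

variable {K : Type*} [Field K] {σ : Type*} [Fintype σ]

theorem derivation_aeval {A : Type*} [CommRing A] [Algebra K A] (D : Derivation K A A) (y : σ → A)
    (P : MvPolynomial σ K) : D (aeval y P) = ∑ a, aeval y (pderiv a P) * D (y a) := by
  classical
  induction P using MvPolynomial.induction_on with
  | C c => simp
  | add p q hp hq => simp only [map_add, hp, hq, add_mul, Finset.sum_add_distrib]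
  | mul_X p i hp =>
    simp only [map_mul, aeval_X, Derivation.leibniz, hp, smul_eq_mul, map_add, pderiv_X, add_mul,
      Finset.sum_add_distrib, Finset.mul_sum]
    congr 1
    · rw [Finset.sum_eq_single i]
      · simp
      · intro b _ hb
        simp [hb.symm]
      · simp
    · exact Finset.sum_congr rfl fun a _ => by ring

/-- The first order expansion of a polynomial. -/
theorem aeval_inl_add_inr {E : Type*} [Field E] [Algebra K E] (y v : σ → E)
    (P : MvPolynomial σ K) :
    aeval (fun i => (TrivSqZeroExt.inl (y i) + TrivSqZeroExt.inr (v i) : TrivSqZeroExt E E)) P =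
      TrivSqZeroExt.inl (aeval y P) +
        TrivSqZeroExt.inr (∑ a, aeval y (pderiv a P) * v a) := by
  classical
  induction P using MvPolynomial.induction_on with
  | C c => simp [TrivSqZeroExt.algebraMap_eq_inl']
  | add p q hp hq =>
    simp only [map_add, hp, hq, add_mul, Finset.sum_add_distrib, TrivSqZeroExt.inl_add,
      TrivSqZeroExt.inr_add]
    ring
  | mul_X p i hp =>
    have hs : ∑ a, aeval y (pderiv a (p * X i)) * v a =
        aeval y p * v i + y i * ∑ a, aeval y (pderiv a p) * v a := by
      simp only [Derivation.leibniz, smul_eq_mul, map_add, map_mul, aeval_X, pderiv_X, add_mul,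
        Finset.sum_add_distrib, Finset.mul_sum]
      congr 1
      · rw [Finset.sum_eq_single i]
        · simp
        · intro b _ hb
          simp [hb.symm]
        · simp
      · exact Finset.sum_congr rfl fun a _ => by ring
    rw [map_mul, hp, aeval_X, hs, map_mul, aeval_X]
    ext
    · simp
    · simp [mul_comm, add_comm]

/-- Field extensions of a perfect field are formally smooth, so the identity of `E` lifts through a
square-zero extension, compatibly with the structure that `f` puts on `B`. -/
theorem exists_section_of_sq_zero {F E B : Type*} [Field F] [Field E] [CommRing B] [Algebra F E]
    [CharZero F] [Algebra.EssFiniteType F E] (f : F →+* B) (π : B →+* E)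
    (hπ : Function.Surjective π) (hsq : RingHom.ker π ^ 2 = ⊥)
    (hf : ∀ a, π (f a) = algebraMap F E a) :
    ∃ Ψ : E →+* B, (∀ e, π (Ψ e) = e) ∧ ∀ a, Ψ (algebraMap F E a) = f a := by
  let := f.toAlgebra
  let π' : B →ₐ[F] E := { π with commutes' := hf }
  have := Algebra.FormallySmooth.of_perfectField (K := F) (L := E)
  have hnil : IsNilpotent (RingHom.ker (π' : B →+* E)) := ⟨2, hsq⟩
  let Ψ := Algebra.FormallySmooth.liftOfSurjective (AlgHom.id F E) π' hπ hnil
  exact ⟨Ψ, fun e => Algebra.FormallySmooth.liftOfSurjective_apply (AlgHom.id F E) π' hπ hnil e,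
    Ψ.commutes⟩

/-- A tangent vector at a generic point of a subvariety extends to a derivation of any field of
characteristic zero containing the coordinates of the point. -/
theorem exists_derivation_of_tangent {E : Type*} [Field E] [Algebra K E] [CharZero K]
    [Algebra.EssFiniteType K E] (y v : σ → E)
    (hv : ∀ P : MvPolynomial σ K, aeval y P = 0 → ∑ a, aeval y (pderiv a P) * v a = 0) :
    ∃ D : Derivation K E E, ∀ a, D (y a) = v a := by
  let I : Ideal (MvPolynomial σ K) := RingHom.ker (aeval y : MvPolynomial σ K →ₐ[K] E)
  have hI : I.IsPrime := RingHom.ker_isPrime _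
  let A := MvPolynomial σ K ⧸ I
  let F := FractionRing A
  let j : A →ₐ[K] E := Ideal.Quotient.liftₐ I (aeval y) fun _ h => h
  have hj : Function.Injective j := by
    rw [injective_iff_map_eq_zero]
    intro a ha
    obtain ⟨P, rfl⟩ := Ideal.Quotient.mk_surjective a
    exact Ideal.Quotient.eq_zero_iff_mem.mpr ha
  let j' : F →+* E := IsFractionRing.lift (g := (j : A →+* E)) hj
  have hj' : ∀ a : A, j' (algebraMap A F a) = j a := fun a => IsFractionRing.lift_algebraMap hj a
  let := j'.toAlgebra
  have : IsScalarTower K F E := IsScalarTower.of_algebraMap_eq fun c => by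
    change algebraMap K E c = j' (algebraMap K F c)
    rw [IsScalarTower.algebraMap_apply K A F, hj', AlgHom.commutes]
  have : Algebra.EssFiniteType F E := Algebra.EssFiniteType.of_comp K F E
  have : CharZero F := charZero_of_injective_algebraMap (algebraMap K F).injective
  -- The tangent vector becomes the point `y + εv` over the dual numbers; `hv` says that it
  -- satisfies all the equations of `y`.
  let ψ₀ : MvPolynomial σ K →ₐ[K] TrivSqZeroExt E E :=
    aeval fun i => (TrivSqZeroExt.inl (y i) + TrivSqZeroExt.inr (v i) : TrivSqZeroExt E E)
  have hψ₀ : ∀ P, ψ₀ P = TrivSqZeroExt.inl (aeval y P) +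
        TrivSqZeroExt.inr (∑ a, aeval y (pderiv a P) * v a) := aeval_inl_add_inr y v
  let ψ : A →+* TrivSqZeroExt E E := Ideal.Quotient.lift I
      (ψ₀ : MvPolynomial σ K →+* TrivSqZeroExt E E) fun P hP => by
    change ψ₀ P = 0
    have hP' : aeval y P = 0 := hP
    rw [hψ₀, hP', hv P hP']
    simp
  have hψ : ∀ a : A, (ψ a).fst = j a := by
    intro a
    obtain ⟨P, rfl⟩ := Ideal.Quotient.mk_surjective a
    change (ψ₀ P).fst = aeval y P
    rw [hψ₀, TrivSqZeroExt.fst_add, TrivSqZeroExt.fst_inl, TrivSqZeroExt.fst_inr, add_zero]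
  -- A dual number with nonzero constant part is a unit, so `ψ` extends to the fraction field.
  have hunit : ∀ a : nonZeroDivisors A, IsUnit (ψ a) := by
    intro a
    rw [TrivSqZeroExt.isUnit_iff_isUnit_fst, hψ, isUnit_iff_ne_zero]
    exact (map_ne_zero_iff j hj).mpr (nonZeroDivisors.coe_ne_zero a)
  let f : F →+* TrivSqZeroExt E E := IsLocalization.lift hunit
  have hf : ∀ a : A, f (algebraMap A F a) = ψ a := fun a => IsLocalization.lift_eq hunit a
  let π : TrivSqZeroExt E E →+* E := (TrivSqZeroExt.fstHom E E E : TrivSqZeroExt E E →ₐ[E] E)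
  obtain ⟨Ψ, hΨ1, hΨ2⟩ := exists_section_of_sq_zero f π (fun e => ⟨TrivSqZeroExt.inl e, rfl⟩)
    (by
      rw [eq_bot_iff, pow_two, Ideal.mul_le]
      intro a ha b hb
      have ha' : a.fst = 0 := ha
      have hb' : b.fst = 0 := hb
      change a * b = 0
      ext <;> simp [ha', hb'])
    (by
      intro a
      have : π.comp f = j' := by
        apply IsLocalization.ringHom_ext (nonZeroDivisors A)
        refine RingHom.ext fun a => ?_
        simp only [RingHom.comp_apply, hf, hj']
        exact hψ a
      exact RingHom.congr_fun this a)
  have hΨA : ∀ a : A, Ψ (j a) = ψ a := by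
    intro a
    rw [← hj', ← hf, ← hΨ2]
    rfl
  have hΨK : ∀ c : K, Ψ (algebraMap K E c) = TrivSqZeroExt.inl (algebraMap K E c) := by
    intro c
    rw [← j.commutes c, hΨA]
    change ψ₀ (C c) = _
    rw [hψ₀]
    simp
  have hfst : ∀ e, (Ψ e).fst = e := hΨ1
  -- The `ε`-part of a section into the dual numbers obeys the Leibniz rule.
  let D : Derivation K E E := Derivation.mk'
    { toFun := fun e => (Ψ e).snd
      map_add' := fun a b => by simp
      map_smul' := fun c e => by
        rw [Algebra.smul_def, map_mul, hΨK]
        simp [Algebra.smul_def] }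
    (fun a b => by
      change (Ψ (a * b)).snd = _
      rw [map_mul]
      simp [hfst, mul_comm])
  refine ⟨D, fun a => ?_⟩
  change (Ψ (y a)).snd = v a
  have h1 : j (Ideal.Quotient.mk I (X a)) = y a := by
    change aeval y (X a) = y a
    simp
  have h2 : ψ (Ideal.Quotient.mk I (X a)) =
      TrivSqZeroExt.inl (y a) + TrivSqZeroExt.inr (v a) := by
    change ψ₀ (X a) = _
    exact aeval_X _ a
  rw [← h1, hΨA, h2, TrivSqZeroExt.snd_add, TrivSqZeroExt.snd_inl, TrivSqZeroExt.snd_inr, zero_add]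

/-- An element which is not killed by a derivation is transcendental over any subring killed by
the derivation. -/
theorem transcendental_of_derivation_ne_zero {E : Type*} [Field E] [Algebra K E] [CharZero K]
    (D : Derivation K E E) (A : Subalgebra K E) (hA : ∀ a ∈ A, D a = 0) {x : E} (hx : D x ≠ 0) :
    Transcendental A x := by
  have hD : ∀ p : Polynomial A, D (Polynomial.aeval x p) =
      Polynomial.aeval x (Polynomial.derivative p) * D x := by
    intro p
    induction p using Polynomial.induction_on' with
    | add p q hp hq => simp only [map_add, hp, hq, add_mul]
    | monomial n a =>
      have ha : D (algebraMap A E a) = 0 := hA _ a.2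
      simp only [Polynomial.aeval_monomial, Derivation.leibniz, ha,
        Derivation.leibniz_pow, Polynomial.derivative_monomial, map_mul, map_natCast,
        smul_eq_mul, nsmul_eq_mul]
      ring
  have : CharZero A := charZero_of_injective_algebraMap (algebraMap K A).injective
  -- Applying `D` to `p(x) = 0` gives `p'(x) = 0`, a relation of smaller degree. By induction `p' =
  -- 0`, which in characteristic zero forces `p` to be constant.
  have key : ∀ n, ∀ p : Polynomial A, p.natDegree = n → Polynomial.aeval x p = 0 → p = 0 := by
    intro n
    induction n with
    | zero =>
      intro p hp h0
      rw [Polynomial.eq_C_of_natDegree_eq_zero hp] at h0 ⊢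
      rw [Polynomial.aeval_C] at h0
      rw [(FaithfulSMul.algebraMap_injective A E) (h0.trans (map_zero _).symm), map_zero]
    | succ n ih =>
      intro p hp h0
      have h1 := hD p
      rw [h0, map_zero] at h1
      have h2 := (mul_eq_zero.mp h1.symm).resolve_right hx
      have h3 := ih _ (by rw [Polynomial.natDegree_derivative, hp]; rfl) h2
      have h4 := Polynomial.derivative_eq_zero.mp h3
      omega
  rintro ⟨p, hp0, hp⟩
  exact hp0 (key _ p rfl hp)

end Derivations

/-! ### Generic points and specialization of linear systems. -/

/-- `y` is a generic point, with coordinates in the field `E`, of the Zariski closure of `Y`, and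
`E` is generated as a field by the coordinates of `y`. -/
structure IsGenericCoordinates {K : Type*} [Field K] {σ : Type*} {E : Type*} [Field E] [Algebra K E]
    (Y : Set (σ → K)) (y : σ → E) : Prop where
  aeval_eq_zero_iff : ∀ P : MvPolynomial σ K, aeval y P = 0 ↔ ∀ p ∈ Y, eval p P = 0
  exists_mul_eq : ∀ e : E, ∃ P Q : MvPolynomial σ K, aeval y Q ≠ 0 ∧ e * aeval y Q = aeval y P

namespace IsGenericCoordinates

variable {K : Type*} [Field K] {σ : Type*} {E : Type*} [Field E] [Algebra K E]
  {Y : Set (σ → K)} {y : σ → E}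

theorem exists_common_denominator (hy : IsGenericCoordinates Y y) {s : Set E} (hs : s.Finite) :
    ∃ Q : MvPolynomial σ K, aeval y Q ≠ 0 ∧
      ∀ e ∈ s, ∃ P : MvPolynomial σ K, e * aeval y Q = aeval y P := by
  induction s, hs using Set.Finite.induction_on with
  | empty => exact ⟨1, by simp, by simp⟩
  | @insert a s _ _ ih =>
    obtain ⟨Q, hQ, h⟩ := ih
    obtain ⟨P', Q', hQ', h'⟩ := hy.exists_mul_eq a
    refine ⟨Q' * Q, by rw [map_mul]; exact mul_ne_zero hQ' hQ, ?_⟩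
    rintro e (rfl | he)
    · exact ⟨P' * Q, by rw [map_mul, map_mul, ← h', mul_assoc]⟩
    · obtain ⟨P, hP⟩ := h e he
      exact ⟨P * Q', by rw [map_mul, map_mul, ← hP]; ring⟩

theorem eval_eq_of_aeval_eq (hy : IsGenericCoordinates Y y) {P Q : MvPolynomial σ K}
    (h : aeval y P = aeval y Q) {p : σ → K} (hp : p ∈ Y) : eval p P = eval p Q := by
  have := (hy.aeval_eq_zero_iff (P - Q)).mp (by rw [map_sub, h, sub_self]) p hp
  rwa [map_sub, sub_eq_zero] at this

/-- The linear functional whose coefficients are the values at `y` of polynomials `f i`. -/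
def aevalDual (y : σ → E) {ι : Type*} [Fintype ι] (f : ι → MvPolynomial σ K) : Dual E (ι → E) :=
  Fintype.linearCombination E fun i => aeval y (f i)

theorem aevalDual_apply {ι : Type*} [Fintype ι] (f : ι → MvPolynomial σ K) (v : ι → E) :
    aevalDual y f v = ∑ i, aeval y (f i) * v i := by
  simp [aevalDual, Fintype.linearCombination_apply, mul_comm]

/-- If over the field of the generic point the solutions of a system `S₁` of linear equations with
polynomial coefficients are images under a matrix `B` of solutions of a system `S₂`, then the same
holds at all points of a nonempty open subset. -/
theorem specialize (hy : IsGenericCoordinates Y y) {τ ρ : Type*} [Fintype τ] [Fintype ρ]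
    (S₁ : Set (τ → MvPolynomial σ K)) (B : τ → ρ → MvPolynomial σ K)
    (S₂ : Set (ρ → MvPolynomial σ K))
    (h : ∀ v : τ → E, (∀ f ∈ S₁, ∑ i, aeval y (f i) * v i = 0) →
      ∃ z : ρ → E, (∀ g ∈ S₂, ∑ a, aeval y (g a) * z a = 0) ∧
        ∀ i, v i = ∑ a, aeval y (B i a) * z a) :
    ∃ Q : MvPolynomial σ K, aeval y Q ≠ 0 ∧ ∀ p ∈ Y, eval p Q ≠ 0 →
      ∀ v : τ → K, (∀ f ∈ S₁, ∑ i, eval p (f i) * v i = 0) →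
        ∃ z : ρ → K, (∀ g ∈ S₂, ∑ a, eval p (g a) * z a = 0) ∧
          ∀ i, v i = ∑ a, eval p (B i a) * z a := by
  classical
  let Φ : Submodule E (Dual E (τ → E)) := Submodule.span E (Set.range fun f : S₁ => aevalDual y f.1)
  let V : Submodule E (τ → E) := Φ.dualCoannihilator
  have hV : ∀ v ∈ V, ∀ f ∈ S₁, ∑ i, aeval y (f i) * v i = 0 := by
    intro v hv f hf
    rw [← aevalDual_apply]
    exact (Submodule.mem_dualCoannihilator _).mp hv _ (Submodule.subset_span ⟨⟨f, hf⟩, rfl⟩)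
  let L : Submodule E (ρ → E) :=
    (Submodule.span E (Set.range fun g : S₂ => aevalDual y g.1)).dualCoannihilator
  have hL : ∀ z, z ∈ L ↔ ∀ g ∈ S₂, ∑ a, aeval y (g a) * z a = 0 := by
    intro z
    refine ⟨fun hz g hg => ?_, fun hz => ?_⟩
    · rw [← aevalDual_apply]
      exact (Submodule.mem_dualCoannihilator _).mp hz _ (Submodule.subset_span ⟨⟨g, hg⟩, rfl⟩)
    · rw [Submodule.mem_dualCoannihilator]
      intro φ hφ
      induction hφ using Submodule.span_induction with
      | mem φ hφ =>
        obtain ⟨g, rfl⟩ := hφ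
        rw [aevalDual_apply]
        exact hz _ g.2
      | zero => rfl
      | add φ ψ _ _ h1 h2 => rw [LinearMap.add_apply, h1, h2, add_zero]
      | smul c φ _ h1 => rw [LinearMap.smul_apply, h1, smul_zero]
  let bV := finBasis E V
  have hz : ∀ k, ∃ z : L, ∀ i, (bV k : τ → E) i = ∑ a, aeval y (B i a) * (z : ρ → E) a := by
    intro k
    obtain ⟨z, hz1, hz2⟩ := h _ (hV _ (bV k).2)
    exact ⟨⟨z, (hL z).mpr hz1⟩, hz2⟩
  choose z hz using hz
  -- `U` chooses preimages linearly in `v`. It is extended to the whole space so that it has a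
  -- matrix.
  obtain ⟨U, hU⟩ := LinearMap.exists_extend (bV.constr E z)
  have hUv : ∀ v ∈ V, ∀ i, v i = aevalDual y (B i) (U v) := by
    intro v hv i
    have h1 : (LinearMap.proj i).comp V.subtype =
        (aevalDual y (B i)).comp (L.subtype.comp (U.comp V.subtype)) := by
      apply bV.ext
      intro k
      rw [hU]
      simp only [LinearMap.comp_apply, Submodule.subtype_apply, LinearMap.proj_apply,
        Basis.constr_basis, aevalDual_apply]
      exact hz k i
    exact LinearMap.congr_fun h1 ⟨v, hv⟩
  -- The functional `v_i - B_i(U v)` vanishes on all solutions of `S₁`, so by duality it is a finite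
  -- combination of the equations. This certificate can be specialized.
  have hrow : ∀ i : τ, ∃ c : S₁ →₀ E, (c.sum fun f a => a • aevalDual y f.1) =
      (LinearMap.proj i : (τ → E) →ₗ[E] E) - (aevalDual y (B i)).comp (L.subtype.comp U) := by
    intro i
    rw [← Finsupp.mem_span_range_iff_exists_finsupp]
    change _ ∈ Φ
    rw [← Subspace.dualCoannihilator_dualAnnihilator_eq (W := Φ), Submodule.mem_dualAnnihilator]
    intro v hv
    simp only [LinearMap.sub_apply, LinearMap.comp_apply, Submodule.subtype_apply,
      LinearMap.proj_apply]
    rw [hUv v hv i, sub_self]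
  choose c hc using hrow
  let u : ρ → τ → E := fun a j => (U (Pi.single j 1) : ρ → E) a
  -- One denominator serves the matrix of `U` and all coefficients of the certificates. The cleared
  -- relations are polynomial identities at `y`, hence hold on `Y`.
  obtain ⟨Q, hQ, hden⟩ := hy.exists_common_denominator
    (s := (Set.range fun x : ρ × τ => u x.1 x.2) ∪ ⋃ i, c i '' (c i).support)
    ((Set.finite_range _).union (Set.finite_iUnion fun i => ((c i).support.finite_toSet).image _))
  have hPU : ∀ a j, ∃ P : MvPolynomial σ K, u a j * aeval y Q = aeval y P :=
    fun a j => hden _ (Or.inl ⟨(a, j), rfl⟩)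
  have hPC : ∀ i f, ∃ P : MvPolynomial σ K, c i f * aeval y Q = aeval y P := by
    intro i f
    by_cases hf : f ∈ (c i).support
    · exact hden _ (Or.inr (Set.mem_iUnion.mpr ⟨i, f, hf, rfl⟩))
    · exact ⟨0, by rw [Finsupp.notMem_support_iff.mp hf, zero_mul, map_zero]⟩
  choose PU hPU using hPU
  choose PC hPC using hPC
  refine ⟨Q, hQ, fun p hp hQp v hv => ?_⟩
  have hrel : ∀ i j, ∑ f ∈ (c i).support, eval p (PC i f) * eval p (f.1 j) =
      eval p Q * (if i = j then 1 else 0) - ∑ a, eval p (B i a) * eval p (PU a j) := by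
    intro i j
    have h1 := LinearMap.congr_fun (hc i) (Pi.single j 1)
    simp only [Finsupp.sum, LinearMap.sum_apply, LinearMap.smul_apply, LinearMap.sub_apply,
      LinearMap.comp_apply, LinearMap.proj_apply, Submodule.subtype_apply, aevalDual_apply,
      smul_eq_mul,
      Pi.single_apply, mul_ite, mul_one, mul_zero, Finset.sum_ite_eq', Finset.mem_univ,
      if_true] at h1
    have h2 : aeval y (∑ f ∈ (c i).support, PC i f * f.1 j) =
        aeval y (Q * (if i = j then 1 else 0) - ∑ a, B i a * PU a j) := by
      simp only [map_sub, map_sum, map_mul, ← hPU, ← hPC]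
      rw [show ∑ f ∈ (c i).support, c i f * aeval y Q * aeval y (f.1 j) =
        aeval y Q * ∑ f ∈ (c i).support, c i f * aeval y (f.1 j) by
          rw [Finset.mul_sum]; exact Finset.sum_congr rfl fun f _ => by ring, h1, mul_sub,
        Finset.mul_sum]
      congr 1
      · split_ifs <;> simp
      · exact Finset.sum_congr rfl fun a _ => by simp only [u]; ring
    have h3 := hy.eval_eq_of_aeval_eq h2 hp
    simp only [map_sub, map_sum, map_mul] at h3
    rw [h3]
    split_ifs <;> simp
  have hg0 : ∀ g ∈ S₂, ∀ j, ∑ a, eval p (g a) * eval p (PU a j) = 0 := by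
    intro g hg j
    have h1 := (hL _).mp (U (Pi.single j 1)).2 g hg
    have h2 : aeval y (∑ a, g a * PU a j) = aeval y (0 : MvPolynomial σ K) := by
      simp only [map_sum, map_mul, ← hPU, map_zero]
      rw [← zero_mul (aeval y Q), ← h1, Finset.sum_mul]
      exact Finset.sum_congr rfl fun a _ => by simp only [u]; ring
    have h3 := hy.eval_eq_of_aeval_eq h2 hp
    simpa only [map_sum, map_mul, map_zero] using h3
  -- The specialization of `U` at `p`, applied to `v`.
  refine ⟨fun a => (eval p Q)⁻¹ * ∑ j, eval p (PU a j) * v j, fun g hg => ?_, fun i => ?_⟩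
  · calc ∑ a, eval p (g a) * ((eval p Q)⁻¹ * ∑ j, eval p (PU a j) * v j)
        = (eval p Q)⁻¹ * ∑ j, (∑ a, eval p (g a) * eval p (PU a j)) * v j := by
          simp only [Finset.mul_sum, Finset.sum_mul]
          rw [Finset.sum_comm]
          exact Finset.sum_congr rfl fun _ _ => Finset.sum_congr rfl fun _ _ => by ring
      _ = 0 := by simp [hg0 g hg]
  · have h1 : ∑ j, (∑ f ∈ (c i).support, eval p (PC i f) * eval p (f.1 j)) * v j = 0 := by
      simp only [Finset.sum_mul]
      rw [Finset.sum_comm]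
      refine Finset.sum_eq_zero fun f _ => ?_
      have := hv f.1 f.2
      rw [← mul_zero (eval p (PC i f)), ← this, Finset.mul_sum]
      exact Finset.sum_congr rfl fun _ _ => by ring
    simp only [hrel, sub_mul, Finset.sum_sub_distrib, mul_ite, mul_one, mul_zero, ite_mul,
      zero_mul, Finset.sum_ite_eq, Finset.mem_univ, if_true] at h1
    rw [sub_eq_zero] at h1
    apply mul_left_cancel₀ hQp
    rw [h1, Finset.mul_sum]
    simp only [Finset.sum_mul, Finset.mul_sum]
    rw [Finset.sum_comm]
    refine Finset.sum_congr rfl fun a _ => Finset.sum_congr rfl fun j _ => ?_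
    field_simp

end IsGenericCoordinates

/-! ### Polynomials along the rulings of a cone. -/

section Scaling

variable {K : Type*} [Field K] {σ : Type*}

theorem eval_smul_of_isHomogeneous [Fintype σ] {F : MvPolynomial σ K} {d : ℕ}
    (hF : F.IsHomogeneous d) (c : K) (w : σ → K) : eval (c • w) F = c ^ d * eval w F := by
  rw [eval_eq', eval_eq', Finset.mul_sum]
  refine Finset.sum_congr rfl fun m hm => ?_
  have hdeg : ∑ i, m i = d := by
    have := hF (mem_support_iff.mp hm)
    simpa [Finsupp.weight_apply, Finsupp.sum_fintype] using this
  simp only [Pi.smul_apply, smul_eq_mul, mul_pow, Finset.prod_mul_distrib,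
    Finset.prod_pow_eq_pow_sum, hdeg]
  ring

/-- The restriction of `F` to the line through `0` and `w`. -/
def scalingPolynomial (F : MvPolynomial σ K) (w : σ → K) : Polynomial K :=
  ∑ d ∈ Finset.range (F.totalDegree + 1),
    Polynomial.monomial d (eval w (homogeneousComponent d F))

theorem eval_scalingPolynomial [Fintype σ] (F : MvPolynomial σ K) (w : σ → K) (c : K) :
    (scalingPolynomial F w).eval c = eval (c • w) F := by
  conv_rhs => rw [← sum_homogeneousComponent F, map_sum]
  rw [scalingPolynomial, Polynomial.eval_finsetSum]
  refine Finset.sum_congr rfl fun d _ => ?_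
  rw [eval_smul_of_isHomogeneous (homogeneousComponent_isHomogeneous d F),
    Polynomial.eval_monomial, mul_comm]

theorem coeff_scalingPolynomial (F : MvPolynomial σ K) (w : σ → K) (d : ℕ) :
    (scalingPolynomial F w).coeff d = eval w (homogeneousComponent d F) := by
  rw [scalingPolynomial, Polynomial.finsetSum_coeff]
  simp only [Polynomial.coeff_monomial, Finset.sum_ite_eq', Finset.mem_range]
  split_ifs with h
  · rfl
  · rw [homogeneousComponent_eq_zero _ _ (by omega), map_zero]

theorem scalingPolynomial_ne_zero {F : MvPolynomial σ K} {w : σ → K} {d : ℕ}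
    (h : eval w (homogeneousComponent d F) ≠ 0) : scalingPolynomial F w ≠ 0 := by
  intro h0
  rw [← coeff_scalingPolynomial, h0] at h
  simp at h

theorem exists_homogeneousComponent_eval_ne_zero {F : MvPolynomial σ K} {w : σ → K}
    (h : eval w F ≠ 0) : ∃ d, eval w (homogeneousComponent d F) ≠ 0 := by
  by_contra! h0
  apply h
  rw [← sum_homogeneousComponent F, map_sum]
  exact Finset.sum_eq_zero fun d _ => h0 d

theorem exists_ne_zero_eval_ne_zero [Infinite K] {p : Polynomial K} (hp : p ≠ 0) :
    ∃ c, c ≠ 0 ∧ p.eval c ≠ 0 := by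
  by_contra! h
  have : Polynomial.X * p = 0 := by
    refine Polynomial.funext fun c => ?_
    by_cases hc : c = 0
    · simp [hc]
    · simp [h c hc]
  exact (mul_ne_zero Polynomial.X_ne_zero hp) this

end Scaling

/-! ### The function field of a cylinder. -/

/-- The product of a variety with an affine plane. -/
def cylinder {K τ : Type*} (C : Set (τ → K)) : Set (Fin 2 ⊕ τ → K) :=
  {p | (fun i => p (Sum.inr i)) ∈ C}

theorem eval_eq_eval_map_sumAlgEquiv {K : Type*} [Field K] {τ : Type*} (p : Fin 2 ⊕ τ → K)
    (P : MvPolynomial (Fin 2 ⊕ τ) K) :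
    eval p P = eval (fun i => p (Sum.inl i))
      (MvPolynomial.map (eval fun i => p (Sum.inr i)) (sumAlgEquiv K (Fin 2) τ P)) := by
  induction P using MvPolynomial.induction_on with
  | C c => simp
  | add p q hp hq => simp only [map_add, hp, hq]
  | mul_X q i hq =>
    rw [map_mul, map_mul, map_mul, map_mul, hq]
    congr 1
    rcases i with i | i <;> simp

/-- The field is the fraction field of `R₀[s₀, s₁]`, with `R₀` the coordinate ring of `C`; the two
variables account for the `2`. Over an infinite field a polynomial vanishing on the cylinder has all
its coefficients in `s` zero in `R₀`. -/
theorem exists_genericCoordinates_cylinder {K : Type u} [Field K] [Infinite K] {τ : Type}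
    [Fintype τ] (C : Set (τ → K)) (hC : (vanishingIdeal K C).IsPrime) :
    ∃ (E : Type u) (_ : Field E) (_ : Algebra K E) (y : Fin 2 ⊕ τ → E),
      IsGenericCoordinates (cylinder C) y ∧ Algebra.EssFiniteType K E ∧
        Algebra.trdeg K E = Algebra.trdeg K (MvPolynomial τ K ⧸ vanishingIdeal K C) + 2 := by
  let R₀ := MvPolynomial τ K ⧸ vanishingIdeal K C
  let R := MvPolynomial (Fin 2) R₀
  let E := FractionRing R
  let ψ : MvPolynomial (Fin 2 ⊕ τ) K →+* R :=
    (MvPolynomial.map (Ideal.Quotient.mk (vanishingIdeal K C))).comp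
      (sumAlgEquiv K (Fin 2) τ : _ →+* _)
  have hψsurj : Function.Surjective ψ :=
    (MvPolynomial.map_surjective _ Ideal.Quotient.mk_surjective).comp
      (sumAlgEquiv K (Fin 2) τ).surjective
  let y : Fin 2 ⊕ τ → E := fun i => algebraMap R E (ψ (X i))
  have hy : ∀ P, aeval y P = algebraMap R E (ψ P) := by
    intro P
    induction P using MvPolynomial.induction_on with
    | C c =>
      rw [aeval_C, IsScalarTower.algebraMap_apply K R E]
      congr 1
      simp [ψ]
      rfl
    | add p q hp hq => simp only [map_add, hp, hq]
    | mul_X q i hq => rw [map_mul, map_mul, map_mul, hq, aeval_X]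
  have hinj : Function.Injective (algebraMap R E) := IsFractionRing.injective R E
  refine ⟨E, inferInstance, inferInstance, y, ⟨fun P => ?_, fun e => ?_⟩, ?_, ?_⟩
  · rw [hy, map_eq_zero_iff _ hinj]
    constructor
    · intro h p hp
      rw [eval_eq_eval_map_sumAlgEquiv]
      have : MvPolynomial.map (eval fun i => p (Sum.inr i)) (sumAlgEquiv K (Fin 2) τ P) = 0 := by
        ext m
        rw [coeff_map, coeff_zero]
        have h1 := congrArg (coeff m) h
        simp only [ψ, RingHom.comp_apply, coeff_map, coeff_zero] at h1
        have h2 := Ideal.Quotient.eq_zero_iff_mem.mp h1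
        exact h2 _ hp
      rw [this, map_zero]
    · intro h
      ext m
      simp only [ψ, RingHom.comp_apply, coeff_map, coeff_zero]
      rw [Ideal.Quotient.eq_zero_iff_mem]
      intro w hw
      have : MvPolynomial.map (eval w) (sumAlgEquiv K (Fin 2) τ P) = 0 := by
        refine MvPolynomial.funext fun s => ?_
        have := h (Sum.elim s w) hw
        rw [eval_eq_eval_map_sumAlgEquiv] at this
        simpa using this
      have h1 := congrArg (coeff m) this
      rwa [coeff_map, coeff_zero] at h1
  · obtain ⟨a, b, hb, rfl⟩ := IsFractionRing.div_surjective R e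
    obtain ⟨P, rfl⟩ := hψsurj a
    obtain ⟨Q, rfl⟩ := hψsurj b
    have hne : algebraMap R E (ψ Q) ≠ 0 :=
      IsFractionRing.to_map_ne_zero_of_mem_nonZeroDivisors hb
    exact ⟨P, Q, by rwa [hy], by rw [hy, hy, div_mul_cancel₀ _ hne]⟩
  · have : Algebra.FiniteType K R := Algebra.FiniteType.trans (S := R₀) inferInstance inferInstance
    exact .comp K R E
  · have : Algebra.IsAlgebraic R E := IsLocalization.isAlgebraic _ (nonZeroDivisors R)
    rw [← trdeg_add_eq K R (A := E), trdeg_eq_zero (R := R) (A := E), add_zero,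
      ← trdeg_add_eq K R₀ (A := R), MvPolynomial.trdeg_of_isDomain]
    simp
    rfl

/-! ### Plücker vectors and irreducibility of the Plücker cone. -/

namespace ProjLine

variable {K : Type*} [Field K] {N : ℕ}

theorem plucker_smul_add (u v : Fin (N + 1) → K) (a b c d : K) :
    plucker (a • u + b • v) (c • u + d • v) = (a * d - b * c) • plucker u v := by
  funext ij
  simp only [plucker, Pi.add_apply, Pi.smul_apply, smul_eq_mul]
  ring

theorem plucker_smul_add_deriv (u v u' v' : Fin (N + 1) → K) (a b c d : K) :
    plucker (a • u' + b • v') (c • u + d • v) + plucker (a • u + b • v) (c • u' + d • v') =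
      (a * d - b * c) • (plucker u' v + plucker u v') := by
  funext ij
  simp only [plucker, Pi.add_apply, Pi.smul_apply, smul_eq_mul]
  ring

theorem plucker_ne_zero {u v : Fin (N + 1) → K} (h : LinearIndependent K ![u, v]) :
    plucker u v ≠ 0 := by
  intro h0
  have h1 : ∀ i j, u i * v j - u j * v i = 0 := fun i j => congrFun h0 (i, j)
  have hu : u ≠ 0 := h.ne_zero 0
  obtain ⟨i, hi⟩ := Function.ne_iff.mp hu
  rw [LinearIndependent.pair_iff] at h
  refine hi (neg_eq_zero.mp (h (v i) (-u i) ?_).2)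
  funext j
  have := h1 i j
  simp only [Pi.add_apply, Pi.smul_apply, smul_eq_mul, Pi.zero_apply]
  linear_combination -this

variable (r : ProjLine K N)

theorem pluckerVec_ne_zero (b : Basis (Fin 2) K r.hat) : r.pluckerVec b ≠ 0 := by
  apply plucker_ne_zero
  have := b.linearIndependent.map' r.hat.subtype (Submodule.ker_subtype _)
  have h2 : ![(b 0 : Fin (N + 1) → K), (b 1 : Fin (N + 1) → K)] = r.hat.subtype ∘ b := by
    funext i
    fin_cases i <;> rfl
  rw [h2]
  exact this

/-- The change of basis of a line. -/
theorem exists_basis_change (b b' : Basis (Fin 2) K r.hat) :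
    ∃ a₀₀ a₀₁ a₁₀ a₁₁ : K, a₀₀ * a₁₁ - a₀₁ * a₁₀ ≠ 0 ∧ b' 0 = a₀₀ • b 0 + a₀₁ • b 1 ∧
      b' 1 = a₁₀ • b 0 + a₁₁ • b 1 := by
  have h0 : b' 0 = b.repr (b' 0) 0 • b 0 + b.repr (b' 0) 1 • b 1 := by
    conv_lhs => rw [← b.sum_repr (b' 0), Fin.sum_univ_two]
  have h1 : b' 1 = b.repr (b' 1) 0 • b 0 + b.repr (b' 1) 1 • b 1 := by
    conv_lhs => rw [← b.sum_repr (b' 1), Fin.sum_univ_two]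
  refine ⟨_, _, _, _, fun hdet => ?_, h0, h1⟩
  apply r.pluckerVec_ne_zero b'
  rw [pluckerVec, h0, h1]
  simp only [Submodule.coe_add, Submodule.coe_smul]
  rw [plucker_smul_add, hdet, zero_smul]

theorem exists_pluckerVec_eq_smul (b b' : Basis (Fin 2) K r.hat) :
    ∃ c : K, c ≠ 0 ∧ r.pluckerVec b' = c • r.pluckerVec b := by
  obtain ⟨a₀₀, a₀₁, a₁₀, a₁₁, hc, h0, h1⟩ := r.exists_basis_change b b'
  refine ⟨_, hc, ?_⟩
  rw [pluckerVec, h0, h1]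
  simp only [Submodule.coe_add, Submodule.coe_smul]
  exact plucker_smul_add _ _ _ _ _ _

theorem exists_basis_smul (b : Basis (Fin 2) K r.hat) {c : K} (hc : c ≠ 0) :
    ∃ b' : Basis (Fin 2) K r.hat, r.pluckerVec b' = c • r.pluckerVec b := by
  refine ⟨b.unitsSMul ![Units.mk0 c hc, 1], ?_⟩
  funext ij
  simp [pluckerVec, plucker, Basis.unitsSMul_apply, Units.smul_def]
  ring

variable {r}

theorem smul_mem_pluckerCone {B : Set (ProjLine K N)} {w : Fin (N + 1) × Fin (N + 1) → K}
    (hw : w ∈ pluckerCone B) {c : K} (hc : c ≠ 0) : c • w ∈ pluckerCone B := by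
  obtain ⟨r, hr, b, rfl⟩ := hw
  obtain ⟨b', hb'⟩ := r.exists_basis_smul b hc
  exact ⟨r, hr, b', hb'.symm⟩

/-- The lines at whose Plücker vectors `F` does not vanish. -/
def basicOpen (F : MvPolynomial (Fin (N + 1) × Fin (N + 1)) K) : Set (ProjLine K N) :=
  {r | ∀ b : Basis (Fin 2) K r.hat, eval (r.pluckerVec b) F ≠ 0}

theorem isOpen_basicOpen {F : MvPolynomial (Fin (N + 1) × Fin (N + 1)) K} {d : ℕ}
    (hF : F.IsHomogeneous d) : IsOpen (basicOpen F) :=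
  TopologicalSpace.isOpen_generateFrom_of_mem ⟨d, F, hF, rfl⟩

theorem mem_basicOpen {F : MvPolynomial (Fin (N + 1) × Fin (N + 1)) K} {d : ℕ}
    (hF : F.IsHomogeneous d) {r : ProjLine K N} {b : Basis (Fin 2) K r.hat}
    (h : eval (r.pluckerVec b) F ≠ 0) : r ∈ basicOpen F := by
  intro b'
  obtain ⟨c, hc, hb'⟩ := r.exists_pluckerVec_eq_smul b b'
  rw [hb', eval_smul_of_isHomogeneous hF]
  exact mul_ne_zero (pow_ne_zero _ hc) h

/-- A polynomial which is nonzero somewhere on the Plücker cone of `B` is nonzero, after scaling,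
on a nonempty open subset of `B`. -/
theorem exists_isOpen_of_eval_ne_zero {B : Set (ProjLine K N)}
    {F : MvPolynomial (Fin (N + 1) × Fin (N + 1)) K} {w : Fin (N + 1) × Fin (N + 1) → K}
    (hw : w ∈ pluckerCone B) (hF : eval w F ≠ 0) :
    ∃ U : Set (ProjLine K N), IsOpen U ∧ (B ∩ U).Nonempty ∧
      ∀ r ∈ U, ∀ b : Basis (Fin 2) K r.hat, scalingPolynomial F (r.pluckerVec b) ≠ 0 := by
  obtain ⟨r, hr, b, rfl⟩ := hw
  obtain ⟨d, hd⟩ := exists_homogeneousComponent_eval_ne_zero hF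
  have hh := homogeneousComponent_isHomogeneous d F
  exact ⟨basicOpen (homogeneousComponent d F), isOpen_basicOpen hh, ⟨r, hr, mem_basicOpen hh hd⟩,
    fun r hr b => scalingPolynomial_ne_zero (hr b)⟩

/-- Two polynomials not vanishing on the cone define nonempty open subsets of `B`, which share a
line. As the polynomials need not be homogeneous, a single multiple of its Plücker vector is then
chosen at which both are nonzero. -/
theorem isPrime_vanishingIdeal_pluckerCone [Infinite K] {B : Set (ProjLine K N)}
    (hB : IsIrreducible B) : (vanishingIdeal K (pluckerCone B)).IsPrime := by
  constructor
  · obtain ⟨r, hr⟩ := hB.1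
    have b : Basis (Fin 2) K r.hat := finBasisOfFinrankEq K _ r.finrank_hat
    intro htop
    have : (1 : MvPolynomial _ K) ∈ vanishingIdeal K (pluckerCone B) := htop ▸ Submodule.mem_top
    simpa using this _ ⟨r, hr, b, rfl⟩
  · intro F G hFG
    by_contra! h
    obtain ⟨hF, hG⟩ := h
    simp only [mem_vanishingIdeal_iff, not_forall] at hF hG
    obtain ⟨w₁, hw₁, hF⟩ := hF
    obtain ⟨w₂, hw₂, hG⟩ := hG
    obtain ⟨U, hU, hBU, hFU⟩ := exists_isOpen_of_eval_ne_zero hw₁ hF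
    obtain ⟨V, hV, hBV, hGV⟩ := exists_isOpen_of_eval_ne_zero hw₂ hG
    obtain ⟨r, hr, hrU, hrV⟩ := hB.2 U V hU hV hBU hBV
    have b : Basis (Fin 2) K r.hat := finBasisOfFinrankEq K _ r.finrank_hat
    obtain ⟨c, hc, hne⟩ := exists_ne_zero_eval_ne_zero (mul_ne_zero (hFU r hrU b) (hGV r hrV b))
    rw [Polynomial.eval_mul, eval_scalingPolynomial, eval_scalingPolynomial, ← map_mul] at hne
    exact hne (hFG _ (smul_mem_pluckerCone ⟨r, hr, b, rfl⟩ hc))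

end ProjLine

/-! ### Functoriality of Zariski tangent spaces. -/

section Tangent

variable {K : Type*} [Field K] {σ τ : Type*} [Fintype σ] [Fintype τ]

theorem eval_bind₁ {ι κ : Type*} (g : κ → MvPolynomial ι K) (F : MvPolynomial κ K) (p : ι → K) :
    eval p (bind₁ g F) = eval (fun i => eval p (g i)) F :=
  eval₂Hom_bind₁ (RingHom.id K) p g F

/-- The chain rule for polynomials. -/
theorem sum_eval_pderiv_bind₁ (g : τ → MvPolynomial σ K) (F : MvPolynomial τ K) (p v : σ → K) :
    ∑ j, eval p (pderiv j (bind₁ g F)) * v j =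
      ∑ i, eval (fun i => eval p (g i)) (pderiv i F) * ∑ j, eval p (pderiv j (g i)) * v j := by
  let D : Derivation K (MvPolynomial σ K) (MvPolynomial σ K) := mkDerivation K fun j => C (v j)
  have hD : ∀ P, eval p (D P) = ∑ j, eval p (pderiv j P) * v j := by
    intro P
    have h := derivation_aeval D X P
    rw [aeval_X_left_apply] at h
    simp [h, D, map_sum]
  have h := congrArg (eval p) (derivation_aeval D g F)
  rw [← aeval_eq_bind₁, ← hD, h, map_sum]
  refine Finset.sum_congr rfl fun i _ => ?_
  rw [map_mul, hD]
  congr 1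
  rw [aeval_eq_bind₁, eval_bind₁]

/-- This is the chain rule. The hypothesis is on ideals, so the map need only send `C` into the
Zariski closure of `C'`. -/
theorem affineTangent_map {C : Set (σ → K)} {C' : Set (τ → K)} (g : τ → MvPolynomial σ K)
    (hg : ∀ F ∈ vanishingIdeal K C', bind₁ g F ∈ vanishingIdeal K C) {p v : σ → K} {p' v' : τ → K}
    (hp' : ∀ i, eval p (g i) = p' i) (hv : v ∈ affineTangent C p)
    (hv' : ∀ i, ∑ j, eval p (pderiv j (g i)) * v j = v' i) : v' ∈ affineTangent C' p' := by
  intro F hF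
  have h := hv _ (hg F hF)
  rw [sum_eval_pderiv_bind₁] at h
  simpa only [hp', hv'] using h

theorem mem_affineTangent_univ [Infinite K] (p v : σ → K) : v ∈ affineTangent Set.univ p := by
  intro F hF
  have : F = 0 := MvPolynomial.funext fun x => by simpa [aeval_eq_eval] using hF x trivial
  simp [this]

end Tangent

/-! ### The map sweeping out the union of the lines. -/

section Sweep

variable {K : Type*} [Field K] {N : ℕ}

/-- The point `∑ a, s a • w (m a, ·)` for `y = (s, w)`: if `w` is the Plücker vector of a line, this
is a point of the line. -/
def sweep {A : Type*} [CommRing A] (m : Fin 2 → Fin (N + 1))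
    (y : Fin 2 ⊕ Fin (N + 1) × Fin (N + 1) → A) (i : Fin (N + 1)) : A :=
  ∑ a, y (Sum.inl a) * y (Sum.inr (m a, i))

/-- The derivative of `sweep` at `y` in the direction `z`. -/
def sweepDeriv {A : Type*} [CommRing A] (m : Fin 2 → Fin (N + 1))
    (y z : Fin 2 ⊕ Fin (N + 1) × Fin (N + 1) → A) (i : Fin (N + 1)) : A :=
  ∑ a, (z (Sum.inl a) * y (Sum.inr (m a, i)) + y (Sum.inl a) * z (Sum.inr (m a, i)))

/-- The coordinates of `sweep` as polynomials. -/
def sweepPoly (K : Type*) [Field K] (m : Fin 2 → Fin (N + 1)) (i : Fin (N + 1)) :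
    MvPolynomial (Fin 2 ⊕ Fin (N + 1) × Fin (N + 1)) K :=
  sweep m X i

theorem aeval_sweepPoly {A : Type*} [CommRing A] [Algebra K A] (m : Fin 2 → Fin (N + 1))
    (y : Fin 2 ⊕ Fin (N + 1) × Fin (N + 1) → A) (i : Fin (N + 1)) :
    aeval y (sweepPoly K m i) = sweep m y i := by
  simp [sweepPoly, sweep]

theorem eval_sweepPoly (m : Fin 2 → Fin (N + 1)) (p : Fin 2 ⊕ Fin (N + 1) × Fin (N + 1) → K)
    (i : Fin (N + 1)) : eval p (sweepPoly K m i) = sweep m p i := by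
  simp [sweepPoly, sweep]

theorem derivation_sweep {A : Type*} [CommRing A] [Algebra K A] (D : Derivation K A A)
    (m : Fin 2 → Fin (N + 1)) (y : Fin 2 ⊕ Fin (N + 1) × Fin (N + 1) → A) (i : Fin (N + 1)) :
    D (sweep m y i) = sweepDeriv m y (fun a => D (y a)) i := by
  simp only [sweep, sweepDeriv, map_sum, Derivation.leibniz, smul_eq_mul]
  exact Finset.sum_congr rfl fun a _ => by ring

theorem sum_aeval_pderiv_sweepPoly {A : Type*} [CommRing A] [Algebra K A]
    (m : Fin 2 → Fin (N + 1)) (y z : Fin 2 ⊕ Fin (N + 1) × Fin (N + 1) → A) (i : Fin (N + 1)) :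
    ∑ a, aeval y (pderiv a (sweepPoly K m i)) * z a = sweepDeriv m y z i := by
  classical
  simp only [sweepPoly, sweep, map_sum, Derivation.leibniz, smul_eq_mul, map_add, map_mul, aeval_X,
    pderiv_X, Finset.sum_mul, sweepDeriv, add_mul]
  rw [Finset.sum_comm]
  refine Finset.sum_congr rfl fun b _ => ?_
  rw [Finset.sum_add_distrib, add_comm]
  congr 1
  · rw [Finset.sum_eq_single (Sum.inl b)]
    · simp [mul_comm]
    · intro c _ hc
      simp [hc.symm]
    · simp
  · rw [Finset.sum_eq_single (Sum.inr (m b, i))]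
    · simp
    · intro c _ hc
      simp [hc.symm]
    · simp

theorem sum_eval_pderiv_sweepPoly (m : Fin 2 → Fin (N + 1))
    (y z : Fin 2 ⊕ Fin (N + 1) × Fin (N + 1) → K) (i : Fin (N + 1)) :
    ∑ a, eval y (pderiv a (sweepPoly K m i)) * z a = sweepDeriv m y z i := by
  simpa [aeval_eq_eval] using sum_aeval_pderiv_sweepPoly (K := K) m y z i

end Sweep

/-! ### Rows of the Plücker matrix as points of the line. -/

namespace ProjLine

variable {K : Type*} [Field K] {N : ℕ}

/-- The basis of a line formed by two rows of its Plücker matrix. -/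
theorem exists_rowBasis (r : ProjLine K N) (b : Basis (Fin 2) K r.hat) (m : Fin 2 → Fin (N + 1))
    (h : r.pluckerVec b (m 0, m 1) ≠ 0) :
    ∃ c : Basis (Fin 2) K r.hat, (∀ a i, (c a : Fin (N + 1) → K) i = r.pluckerVec b (m a, i)) ∧
      (∀ a, c a = -((b 1 : Fin (N + 1) → K) (m a)) • b 0 + (b 0 : Fin (N + 1) → K) (m a) • b 1) ∧
      r.pluckerVec c = r.pluckerVec b (m 0, m 1) • r.pluckerVec b := by
  let v : Fin 2 → r.hat := fun a =>
    -((b 1 : Fin (N + 1) → K) (m a)) • b 0 + (b 0 : Fin (N + 1) → K) (m a) • b 1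
  have hv : plucker (v 0 : Fin (N + 1) → K) (v 1) =
      r.pluckerVec b (m 0, m 1) • r.pluckerVec b := by
    simp only [v, Submodule.coe_add, Submodule.coe_smul]
    rw [plucker_smul_add]
    congr 1
    simp only [pluckerVec, plucker]
    ring
  have hne : plucker (v 0 : Fin (N + 1) → K) (v 1) ≠ 0 := by
    rw [hv]
    exact smul_ne_zero h (r.pluckerVec_ne_zero b)
  have hli : LinearIndependent K v := by
    have hv2 : v = ![v 0, v 1] := by
      funext i
      fin_cases i <;> rfl
    rw [hv2, LinearIndependent.pair_iff]
    intro s t hst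
    have hst' : s • (v 0 : Fin (N + 1) → K) + t • (v 1 : Fin (N + 1) → K) = 0 :=
      congrArg Subtype.val hst
    -- Wedging the combination with `v 1` and with `v 0` isolates `s` and `t`.
    have h1 := plucker_smul_add (v 0 : Fin (N + 1) → K) (v 1) s t 0 1
    have h2 := plucker_smul_add (v 0 : Fin (N + 1) → K) (v 1) 1 0 s t
    rw [hst'] at h1 h2
    have h3 : (s * 1 - t * 0) • plucker (v 0 : Fin (N + 1) → K) (v 1) = 0 := by
      rw [← h1]; funext ij; simp [plucker]
    have h4 : (1 * t - 0 * s) • plucker (v 0 : Fin (N + 1) → K) (v 1) = 0 := by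
      rw [← h2]; funext ij; simp [plucker]
    simpa using And.intro ((smul_eq_zero.mp h3).resolve_right hne)
      ((smul_eq_zero.mp h4).resolve_right hne)
  let c := basisOfLinearIndependentOfCardEqFinrank hli (by rw [r.finrank_hat]; rfl)
  have hc : ∀ a, c a = v a := fun a => by simp [c]
  refine ⟨c, fun a i => ?_, hc, ?_⟩
  · rw [hc]
    simp only [v, Submodule.coe_add, Submodule.coe_smul, Pi.add_apply, Pi.smul_apply, smul_eq_mul,
      pluckerVec, plucker]
    ring
  · rw [← hv, pluckerVec, hc, hc]

theorem sweep_mem_hat (r : ProjLine K N) (b : Basis (Fin 2) K r.hat) (m : Fin 2 → Fin (N + 1))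
    {p : Fin 2 ⊕ Fin (N + 1) × Fin (N + 1) → K} (hp : ∀ ij, p (Sum.inr ij) = r.pluckerVec b ij) :
    sweep m p ∈ r.hat := by
  have : sweep m p = ∑ a, p (Sum.inl a) •
      (-((b 1 : Fin (N + 1) → K) (m a)) • (b 0 : Fin (N + 1) → K) +
        (b 0 : Fin (N + 1) → K) (m a) • (b 1 : Fin (N + 1) → K)) := by
    funext i
    simp only [sweep, hp, pluckerVec, plucker, Finset.sum_apply, Pi.smul_apply, Pi.add_apply,
      smul_eq_mul]
    exact Finset.sum_congr rfl fun a _ => by ring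
  rw [this]
  exact Submodule.sum_mem _ fun a _ => Submodule.smul_mem _ _
    (Submodule.add_mem _ (Submodule.smul_mem _ _ (b 0).2) (Submodule.smul_mem _ _ (b 1).2))

theorem sweep_mem_unionCone {B : Set (ProjLine K N)} (m : Fin 2 → Fin (N + 1))
    {p : Fin 2 ⊕ Fin (N + 1) × Fin (N + 1) → K} (hp : p ∈ cylinder (pluckerCone B)) :
    sweep m p ∈ unionCone B := by
  obtain ⟨r, hr, b, hb⟩ := hp
  exact ⟨r, hr, r.sweep_mem_hat b m fun ij => congrFun hb ij⟩

/-- Every point of a line is swept out from a nonzero Plücker coordinate. -/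
theorem exists_sweep_eq (r : ProjLine K N) (b : Basis (Fin 2) K r.hat) (m : Fin 2 → Fin (N + 1))
    (h : r.pluckerVec b (m 0, m 1) ≠ 0) {x : Fin (N + 1) → K} (hx : x ∈ r.hat) :
    ∃ s : Fin 2 → K, sweep m (Sum.elim s (r.pluckerVec b)) = x := by
  obtain ⟨c, hc, -, -⟩ := r.exists_rowBasis b m h
  refine ⟨c.repr ⟨x, hx⟩, ?_⟩
  have h1 := congrArg Subtype.val (c.sum_repr ⟨x, hx⟩)
  rw [Submodule.coe_sum] at h1
  conv_rhs => rw [← show _ = x from h1]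
  funext i
  simp [sweep, hc]

/-- The points swept out from one Plücker coordinate are dense in the union of the lines. -/
theorem mem_vanishingIdeal_unionCone_iff {B : Set (ProjLine K N)}
    (hB : (vanishingIdeal K (pluckerCone B)).IsPrime) {m : Fin 2 → Fin (N + 1)}
    (hm : ∃ w ∈ pluckerCone B, w (m 0, m 1) ≠ 0) (F : MvPolynomial (Fin (N + 1)) K) :
    F ∈ vanishingIdeal K (unionCone B) ↔
      ∀ p ∈ cylinder (pluckerCone B), eval p (bind₁ (sweepPoly K m) F) = 0 := by
  simp only [eval_bind₁, eval_sweepPoly]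
  constructor
  · intro hF p hp
    have := hF _ (sweep_mem_unionCone m hp)
    rwa [aeval_eq_eval] at this
  · rintro h x ⟨r, hr, hx⟩
    have b : Basis (Fin 2) K r.hat := finBasisOfFinrankEq K _ r.finrank_hat
    obtain ⟨⟨i, j⟩, hij⟩ := Function.ne_iff.mp (r.pluckerVec_ne_zero b)
    obtain ⟨s, rfl⟩ := r.exists_sweep_eq b ![i, j] hij hx
    let P : MvPolynomial (Fin (N + 1) × Fin (N + 1)) K :=
      bind₁ (fun l => ∑ a, C (s a) * X (![i, j] a, l)) F
    have hP : ∀ w, eval w P = eval (sweep ![i, j] (Sum.elim s w)) F := by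
      intro w
      simp only [P, eval_bind₁]
      congr 2
      funext l
      simp [sweep]
    -- Where the coordinate `(m 0, m 1)` is nonzero, the point swept from `![i, j]` is also swept
    -- from `m`, so `F` vanishes there; elsewhere the factor vanishes. Primality then removes the
    -- factor.
    have hmul : P * X (m 0, m 1) ∈ vanishingIdeal K (pluckerCone B) := by
      rintro w ⟨r', hr', b', rfl⟩
      rw [aeval_eq_eval, map_mul, eval_X, hP]
      by_cases h0 : r'.pluckerVec b' (m 0, m 1) = 0
      · rw [h0, mul_zero]
      · obtain ⟨t, ht⟩ := r'.exists_sweep_eq b' m h0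
          (r'.sweep_mem_hat b' ![i, j] (p := Sum.elim s (r'.pluckerVec b')) fun _ => rfl)
        rw [← ht]
        have := h (Sum.elim t (r'.pluckerVec b')) ⟨r', hr', b', rfl⟩
        change eval (sweep m (Sum.elim t (r'.pluckerVec b'))) F = 0 at this
        rw [this, zero_mul]
    have hX : (X (m 0, m 1) : MvPolynomial _ K) ∉ vanishingIdeal K (pluckerCone B) := by
      intro hX
      obtain ⟨w, hw, hne⟩ := hm
      have := hX w hw
      rw [aeval_X] at this
      exact hne this
    have hPmem := (hB.mem_or_mem hmul).resolve_right hX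
    have := hPmem _ ⟨r, hr, b, rfl⟩
    rwa [aeval_eq_eval, hP] at this

/-- The cone omits its vertex, but a polynomial in `c` with all nonzero scalars as roots is zero; so
`c = 0` is allowed too. -/
theorem eval_smul_eq_zero [Infinite K] {B : Set (ProjLine K N)}
    {F : MvPolynomial (Fin (N + 1) × Fin (N + 1)) K} (hF : F ∈ vanishingIdeal K (pluckerCone B))
    {w : Fin (N + 1) × Fin (N + 1) → K} (hw : w ∈ pluckerCone B) (c : K) :
    eval (c • w) F = 0 := by
  have h : scalingPolynomial F w = 0 := by
    by_contra h0
    obtain ⟨c, hc, hne⟩ := exists_ne_zero_eval_ne_zero h0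
    rw [eval_scalingPolynomial] at hne
    have := hF _ (smul_mem_pluckerCone hw hc)
    rw [aeval_eq_eval] at this
    exact hne this
  rw [← eval_scalingPolynomial, h, Polynomial.eval_zero]

/-- The Plücker cone contains its rulings. -/
theorem self_mem_affineTangent [Infinite K] {B : Set (ProjLine K N)}
    {w : Fin (N + 1) × Fin (N + 1) → K} (hw : w ∈ pluckerCone B) :
    w ∈ affineTangent (pluckerCone B) w := by
  refine affineTangent_map (C := Set.univ) (fun ij => C (w ij) * X ()) (fun F hF p _ => ?_)
    (p := fun _ => 1) (v := fun _ => 1) (fun i => by simp) (mem_affineTangent_univ _ _)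
    (fun i => by simp)
  rw [aeval_eq_eval, eval_bind₁]
  have := eval_smul_eq_zero hF hw (p ())
  convert this using 2
  refine congrArg eval (_root_.funext fun ij => ?_)
  simp [mul_comm]

/-- A vector along the plane and a vector along `C'` are tangent separately, and their sum is the
given one. -/
theorem elim_mem_affineTangent_cylinder [Infinite K] {τ : Type*} [Fintype τ] {C' : Set (τ → K)}
    {p : Fin 2 ⊕ τ → K} (hp : p ∈ cylinder C') {w' : τ → K}
    (hw' : w' ∈ affineTangent C' fun i => p (Sum.inr i)) (s' : Fin 2 → K) :
    Sum.elim s' w' ∈ affineTangent (cylinder C') p := by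
  classical
  have h1 : Sum.elim s' (fun _ => 0) ∈ affineTangent (cylinder C') p := by
    refine affineTangent_map (C := Set.univ)
      (Sum.elim (fun a => X a) fun i => C (p (Sum.inr i))) (fun F hF s _ => ?_)
      (p := fun a => p (Sum.inl a)) (v := s') ?_ (mem_affineTangent_univ _ _) ?_
    · rw [aeval_eq_eval, eval_bind₁]
      have := hF (Sum.elim s fun i => p (Sum.inr i)) hp
      rw [aeval_eq_eval] at this
      convert this using 2
      refine congrArg eval (_root_.funext fun i => ?_)
      rcases i with i | i <;> simp
    · rintro (i | i) <;> simp
    · rintro (i | i) <;> simp [pderiv_X, Pi.single_apply]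
  have h2 : Sum.elim (fun _ => 0) w' ∈ affineTangent (cylinder C') p := by
    refine affineTangent_map (C := C')
      (Sum.elim (fun a => C (p (Sum.inl a))) fun i => X i) (fun F hF w hw => ?_)
      (p := fun a => p (Sum.inr a)) (v := w') ?_ hw' ?_
    · rw [aeval_eq_eval, eval_bind₁]
      have := hF (Sum.elim (fun a => p (Sum.inl a)) w) hw
      rw [aeval_eq_eval] at this
      convert this using 2
      refine congrArg eval (_root_.funext fun i => ?_)
      rcases i with i | i <;> simp
    · rintro (i | i) <;> simp
    · rintro (i | i) <;> simp [pderiv_X, Pi.single_apply]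
  convert add_mem h1 h2 using 1
  funext i
  rcases i with i | i <;> simp

end ProjLine

/-! ### Derivations and transcendence degree. -/

/-- A derivation killing a subring and an element over which the field is algebraic is zero. -/
theorem derivation_eq_zero_of_isAlgebraic_adjoin {K E : Type*} [Field K] [CharZero K] [Field E]
    [Algebra K E] (D : Derivation K E E) (A : Subalgebra K E) (hA : ∀ a ∈ A, D a = 0) {s : Set E}
    (hs : ∀ x ∈ s, D x = 0) (halg : Algebra.IsAlgebraic (Algebra.adjoin A s) E) (x : E) :
    D x = 0 := by
  by_contra hx
  let A' : Subalgebra K E := (Algebra.adjoin A s).restrictScalars K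
  have hA' : ∀ a ∈ A', D a = 0 := by
    intro a ha
    have ha' : a ∈ Algebra.adjoin A s := ha
    induction ha' using Algebra.adjoin_induction with
    | mem x hx => exact hs x hx
    | algebraMap r => exact hA _ r.2
    | add x y hx hy h1 h2 => rw [map_add, h1 hx, h2 hy, add_zero]
    | mul x y hx hy h1 h2 => rw [Derivation.leibniz, h1 hx, h2 hy, smul_zero, smul_zero, add_zero]
  exact transcendental_of_derivation_ne_zero D A' hA' hx (halg.isAlgebraic x)

/-- If the transcendence degree of `E` over a subring is one, a derivation killing the subring is
determined by its value at an element that some such derivation does not kill. -/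
theorem derivation_eq_smul_of_trdeg {K : Type*} {E : Type u} [Field K] [CharZero K] [Field E]
    [Algebra K E] (A : Subalgebra K E) (htr : Algebra.trdeg A E = 1) (D D₀ : Derivation K E E)
    (hD : ∀ a ∈ A, D a = 0) (hD₀ : ∀ a ∈ A, D₀ a = 0) {x : E} (hx : D₀ x ≠ 0) (e : E) :
    D e = D x / D₀ x * D₀ e := by
  have htrans := transcendental_of_derivation_ne_zero D₀ A hD₀ hx
  have hind : AlgebraicIndependent A (fun _ : PUnit.{u + 1} => x) :=
    algebraicIndependent_unique_type_iff.mpr htrans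
  -- In transcendence degree one, `x` is a transcendence basis. So `D - (D x / D₀ x) • D₀`, which
  -- kills `A` and `x`, is zero.
  have hbasis := hind.isTranscendenceBasis_of_trdeg_le_of_finite (by simp [htr])
  have halg := hbasis.isAlgebraic
  have h := derivation_eq_zero_of_isAlgebraic_adjoin (D - (D x / D₀ x) • D₀) A
    (fun a ha => by simp [hD a ha, hD₀ a ha]) (s := Set.range fun _ : PUnit.{u + 1} => x)
    (by rintro _ ⟨-, rfl⟩; simp [div_mul_cancel₀ _ hx]) halg e
  simpa [sub_eq_zero] using h

theorem trdeg_range_aeval {K : Type u} {σ : Type} {E : Type u} [Field K] [Field E] [Algebra K E]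
    (ξ : σ → E) (I : Ideal (MvPolynomial σ K)) (h : ∀ P, P ∈ I ↔ aeval ξ P = 0) :
    Algebra.trdeg K (aeval ξ : MvPolynomial σ K →ₐ[K] E).range =
      Algebra.trdeg K (MvPolynomial σ K ⧸ I) := by
  have hsurj := (aeval ξ : MvPolynomial σ K →ₐ[K] E).rangeRestrict_surjective
  have hI : I = RingHom.ker (aeval ξ : MvPolynomial σ K →ₐ[K] E).rangeRestrict := by
    ext P
    rw [h, RingHom.mem_ker, ← Subtype.coe_inj]
    rfl
  rw [hI]
  exact (Ideal.quotientKerAlgEquivOfSurjective hsurj).trdeg_eq.symm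

/-! ### The sweeping map at the generic point. -/

namespace ProjLine

variable {K : Type u} [Field K] {N : ℕ} {E : Type u} [Field E] [Algebra K E]
  {B : Set (ProjLine K N)} {y : Fin 2 ⊕ Fin (N + 1) × Fin (N + 1) → E}
  {m : Fin 2 → Fin (N + 1)}

/-- By density of the points swept from `m`, `sweep m y` is a generic point of the cone over `X`. -/
theorem aeval_sweep_eq_zero_iff (hy : IsGenericCoordinates (cylinder (pluckerCone B)) y)
    (hB : (vanishingIdeal K (pluckerCone B)).IsPrime)
    (hm : ∃ w ∈ pluckerCone B, w (m 0, m 1) ≠ 0) (F : MvPolynomial (Fin (N + 1)) K) :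
    F ∈ vanishingIdeal K (unionCone B) ↔ aeval (sweep m y) F = 0 := by
  rw [mem_vanishingIdeal_unionCone_iff hB hm, ← hy.aeval_eq_zero_iff, aeval_bind₁]
  simp only [aeval_sweepPoly]

/-- Generic smoothness of the sweeping map: at a general point every tangent vector of the union
comes from a tangent vector of the cylinder over the Plücker cone. -/
theorem exists_sweepDeriv_eq [CharZero K] [Algebra.EssFiniteType K E]
    (hy : IsGenericCoordinates (cylinder (pluckerCone B)) y)
    (hB : (vanishingIdeal K (pluckerCone B)).IsPrime)
    (hm : ∃ w ∈ pluckerCone B, w (m 0, m 1) ≠ 0) :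
    ∃ Q : MvPolynomial (Fin 2 ⊕ Fin (N + 1) × Fin (N + 1)) K, aeval y Q ≠ 0 ∧
      ∀ p ∈ cylinder (pluckerCone B), eval p Q ≠ 0 →
        ∀ v ∈ affineTangent (unionCone B) (sweep m p),
          ∃ z ∈ affineTangent (cylinder (pluckerCone B)) p, sweepDeriv m p z = v := by
  obtain ⟨Q, hQ, h⟩ := hy.specialize
    {f | ∃ F ∈ vanishingIdeal K (unionCone B), f = fun i => bind₁ (sweepPoly K m) (pderiv i F)}
    (fun i a => pderiv a (sweepPoly K m i))
    {g | ∃ P ∈ vanishingIdeal K (cylinder (pluckerCone B)), g = fun a => pderiv a P} (by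
      intro v hv
      -- Over the function field, the tangent vector extends to a derivation of `E`, whose values on
      -- the coordinates `y` are the required lift.
      obtain ⟨D, hD⟩ := exists_derivation_of_tangent (K := K) (sweep m y) v (by
        intro F hF
        have := hv _ ⟨F, (aeval_sweep_eq_zero_iff hy hB hm F).mpr hF, rfl⟩
        simpa only [aeval_bind₁, aeval_sweepPoly] using this)
      refine ⟨fun a => D (y a), ?_, fun i => ?_⟩
      · rintro _ ⟨P, hP, rfl⟩
        rw [← derivation_aeval, (hy.aeval_eq_zero_iff P).mpr, map_zero]
        intro p hp
        have := hP p hp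
        rwa [aeval_eq_eval] at this
      · rw [← hD, derivation_sweep, sum_aeval_pderiv_sweepPoly])
  refine ⟨Q, hQ, fun p hp hpQ v hv => ?_⟩
  obtain ⟨z, hz1, hz2⟩ := h p hp hpQ v (by
    rintro _ ⟨F, hF, rfl⟩
    have := hv F hF
    simpa only [eval_bind₁, eval_sweepPoly] using this)
  refine ⟨z, fun P hP => hz1 _ ⟨P, hP, rfl⟩, ?_⟩
  funext i
  rw [hz2, sum_eval_pderiv_sweepPoly]

/-- The tangent vector at `(s, w)` of the curve `c ↦ (c⁻¹ s, c w)`, which is contracted by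
`sweep`. -/
def eulerVector {A : Type*} [CommRing A] (y : Fin 2 ⊕ Fin (N + 1) × Fin (N + 1) → A) :
    Fin 2 ⊕ Fin (N + 1) × Fin (N + 1) → A :=
  Sum.elim (fun a => -y (Sum.inl a)) fun ij => y (Sum.inr ij)

theorem sweepDeriv_eulerVector {A : Type*} [CommRing A] (m : Fin 2 → Fin (N + 1))
    (y : Fin 2 ⊕ Fin (N + 1) × Fin (N + 1) → A) : sweepDeriv m y (eulerVector y) = 0 := by
  funext i
  simp only [sweepDeriv, eulerVector, Sum.elim_inl, Sum.elim_inr]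
  exact Finset.sum_eq_zero fun a _ => by ring

theorem eulerVector_mem_affineTangent [Infinite K] {p : Fin 2 ⊕ Fin (N + 1) × Fin (N + 1) → K}
    (hp : p ∈ cylinder (pluckerCone B)) :
    eulerVector p ∈ affineTangent (cylinder (pluckerCone B)) p :=
  elim_mem_affineTangent_cylinder hp (self_mem_affineTangent hp) _

theorem map_eulerVector {A A' : Type*} [CommRing A] [CommRing A'] (f : A →+* A')
    (y : Fin 2 ⊕ Fin (N + 1) × Fin (N + 1) → A) (a : Fin 2 ⊕ Fin (N + 1) × Fin (N + 1)) :
    f (eulerVector y a) = eulerVector (fun b => f (y b)) a := by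
  rcases a with a | a <;> simp [eulerVector]

/-- Tangency of the Euler vector at every point is a polynomial identity on the cylinder, hence
holds at the generic point. -/
theorem exists_derivation_eulerVector [CharZero K] [Algebra.EssFiniteType K E]
    (hy : IsGenericCoordinates (cylinder (pluckerCone B)) y) :
    ∃ D : Derivation K E E, ∀ a, D (y a) = eulerVector y a := by
  refine exists_derivation_of_tangent y (eulerVector y) fun P hP => ?_
  have h : aeval y (∑ a, pderiv a P * eulerVector X a) = 0 := by
    rw [hy.aeval_eq_zero_iff]
    intro p hp
    have h1 := eulerVector_mem_affineTangent hp P fun q hq => by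
      rw [aeval_eq_eval]
      exact (hy.aeval_eq_zero_iff P).mp hP q hq
    rw [map_sum, ← h1]
    refine Finset.sum_congr rfl fun a _ => ?_
    rw [map_mul, map_eulerVector]
    simp only [eval_X]
  rw [map_sum] at h
  rw [← h]
  refine Finset.sum_congr rfl fun a _ => ?_
  rw [map_mul]
  have := map_eulerVector (aeval y : _ →ₐ[K] E).toRingHom X a
  simp only [AlgHom.toRingHom_eq_coe, RingHom.coe_coe, aeval_X] at this
  rw [this]

/-- If the union has the expected dimension, then at a general point the kernel of the derivative of
the sweeping map is spanned by the Euler vector. -/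
theorem exists_eq_smul_eulerVector [CharZero K] [Algebra.EssFiniteType K E]
    (hy : IsGenericCoordinates (cylinder (pluckerCone B)) y)
    (hB : (vanishingIdeal K (pluckerCone B)).IsPrime)
    (hm : ∃ w ∈ pluckerCone B, w (m 0, m 1) ≠ 0) {n : ℕ}
    (hX : HasProjectiveDim K (unionCone B) (n + 1))
    (hE : Algebra.trdeg K E = ((n + 1 : ℕ) : Cardinal) + 2) :
    ∃ Q : MvPolynomial (Fin 2 ⊕ Fin (N + 1) × Fin (N + 1)) K, aeval y Q ≠ 0 ∧
      ∀ p ∈ cylinder (pluckerCone B), eval p Q ≠ 0 →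
        ∀ z ∈ affineTangent (cylinder (pluckerCone B)) p, sweepDeriv m p z = 0 →
          ∃ ρ : K, z = ρ • eulerVector p := by
  obtain ⟨D₀, hD₀⟩ := exists_derivation_eulerVector (K := K) hy
  let A : Subalgebra K E := (aeval (sweep m y) : MvPolynomial (Fin (N + 1)) K →ₐ[K] E).range
  have hA : ∀ D : Derivation K E E, (∀ i, D (sweep m y i) = 0) → ∀ a ∈ A, D a = 0 := by
    rintro D hD _ ⟨F, rfl⟩
    change D (aeval (sweep m y) F) = 0
    rw [derivation_aeval]
    simp [hD]
  have hA₀ : ∀ a ∈ A, D₀ a = 0 := hA D₀ fun i => by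
    rw [derivation_sweep, funext hD₀, sweepDeriv_eulerVector, Pi.zero_apply]
  -- The cylinder has dimension `n + 3` and the cone over `X` has dimension `n + 2`.
  have htr : Algebra.trdeg A E = 1 := by
    have h1 := trdeg_add_eq K A (A := E)
    have h2 : Algebra.trdeg K A = ((n + 1 + 1 : ℕ) : Cardinal) :=
      (trdeg_range_aeval (sweep m y) _ (aeval_sweep_eq_zero_iff hy hB hm)).trans hX
    rw [h2, hE] at h1
    refine Cardinal.eq_of_add_eq_add_left (a := ((n + 1 + 1 : ℕ) : Cardinal)) (h1.trans ?_)
      (Cardinal.natCast_lt_aleph0)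
    norm_cast
  -- `D₀` fixes the Plücker coordinates of `y`, and this one is not identically zero.
  have hw0 : D₀ (y (Sum.inr (m 0, m 1))) ≠ 0 := by
    rw [hD₀]
    obtain ⟨w, hw, hne⟩ := hm
    intro h0
    have h1 : aeval y (X (Sum.inr (m 0, m 1)) : MvPolynomial _ K) = 0 := by
      rw [aeval_X]
      exact h0
    have := (hy.aeval_eq_zero_iff _).mp h1 (Sum.elim (fun _ => 0) w) hw
    rw [eval_X] at this
    exact hne this
  -- With one unknown and no equations for `S₂`, the conclusion is that every solution is a multiple
  -- of the Euler vector.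
  obtain ⟨Q, hQ, h⟩ := hy.specialize
    ({f | ∃ P ∈ vanishingIdeal K (cylinder (pluckerCone B)), f = fun a => pderiv a P} ∪
      Set.range fun i => fun a => pderiv a (sweepPoly K m i))
    (fun a (_ : Unit) => eulerVector X a) ∅ (by
      intro z hz
      obtain ⟨D, hD⟩ := exists_derivation_of_tangent (K := K) y z (by
        intro P hP
        refine hz _ (Or.inl ⟨P, fun p hp => ?_, rfl⟩)
        rw [aeval_eq_eval]
        exact (hy.aeval_eq_zero_iff P).mp hP p hp)
      have hDA := hA D fun i => by
        have := hz _ (Or.inr ⟨i, rfl⟩)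
        rw [sum_aeval_pderiv_sweepPoly] at this
        rw [derivation_sweep, funext hD, this]
      refine ⟨fun _ => D (y (Sum.inr (m 0, m 1))) / D₀ (y (Sum.inr (m 0, m 1))), by simp,
        fun a => ?_⟩
      rw [← hD a, derivation_eq_smul_of_trdeg A htr D D₀ hDA hA₀ hw0 (y a), hD₀ a]
      have := map_eulerVector (aeval y : _ →ₐ[K] E).toRingHom X a
      simp only [AlgHom.toRingHom_eq_coe, RingHom.coe_coe, aeval_X] at this
      simp [this, mul_comm])
  refine ⟨Q, hQ, fun p hp hpQ z hz hz0 => ?_⟩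
  obtain ⟨ρ, -, hρ⟩ := h p hp hpQ z (by
    rintro _ (⟨P, hP, rfl⟩ | ⟨i, rfl⟩)
    · exact hz P hP
    · rw [sum_eval_pderiv_sweepPoly, hz0, Pi.zero_apply])
  refine ⟨ρ (), funext fun a => ?_⟩
  rw [hρ a, Fintype.sum_unique, map_eulerVector]
  simp [mul_comm]

end ProjLine

section DirectionalDerivative

variable {K σ : Type*} [Field K] [Fintype σ]

/-- The derivative of a polynomial at `p` in the direction `v`. -/
def dirDeriv (p v : σ → K) (P : MvPolynomial σ K) : K := ∑ j, eval p (pderiv j P) * v j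

theorem dirDeriv_add (p v : σ → K) (P Q : MvPolynomial σ K) :
    dirDeriv p v (P + Q) = dirDeriv p v P + dirDeriv p v Q := by
  simp [dirDeriv, add_mul, Finset.sum_add_distrib]

theorem dirDeriv_sub (p v : σ → K) (P Q : MvPolynomial σ K) :
    dirDeriv p v (P - Q) = dirDeriv p v P - dirDeriv p v Q := by
  simp [dirDeriv, sub_mul, Finset.sum_sub_distrib]

theorem dirDeriv_mul (p v : σ → K) (P Q : MvPolynomial σ K) :
    dirDeriv p v (P * Q) = eval p P * dirDeriv p v Q + eval p Q * dirDeriv p v P := by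
  simp only [dirDeriv, Derivation.leibniz, smul_eq_mul, map_add, map_mul, add_mul,
    Finset.sum_add_distrib, Finset.mul_sum, mul_assoc]

theorem dirDeriv_C (p v : σ → K) (c : K) : dirDeriv p v (C c) = 0 := by
  simp [dirDeriv]

theorem dirDeriv_X (p v : σ → K) (i : σ) : dirDeriv p v (X i) = v i := by
  classical
  simp [dirDeriv, pderiv_X, Pi.single_apply]

end DirectionalDerivative

/-! ### Deformations of a line and tangent vectors of the union. -/

namespace ProjLine

variable {K : Type*} [Field K] {N : ℕ} {B : Set (ProjLine K N)}

theorem plucker_rows (r : ProjLine K N) (b : Basis (Fin 2) K r.hat) (m : Fin 2 → Fin (N + 1)) :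
    plucker (fun i => r.pluckerVec b (m 0, i)) (fun i => r.pluckerVec b (m 1, i)) =
      r.pluckerVec b (m 0, m 1) • r.pluckerVec b := by
  funext ij
  simp only [pluckerVec, plucker, Pi.smul_apply, smul_eq_mul]
  ring

/-- The tangency condition on a first order deformation of a line can be checked in one basis. -/
theorem mem_tangentLifts_of_basis {r : ProjLine K N} (c : Basis (Fin 2) K r.hat)
    {ℓ : r.hat →ₗ[K] (Fin (N + 1) → K)}
    (h : plucker (ℓ (c 0)) (c 1) + plucker (c 0) (ℓ (c 1)) ∈
      affineTangent (pluckerCone B) (r.pluckerVec c)) : ℓ ∈ tangentLifts B r := by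
  intro b
  obtain ⟨a₀₀, a₀₁, a₁₀, a₁₁, hδ, h0, h1⟩ := r.exists_basis_change c b
  have hvec : r.pluckerVec b = (a₀₀ * a₁₁ - a₀₁ * a₁₀) • r.pluckerVec c := by
    rw [pluckerVec, h0, h1]
    simp only [Submodule.coe_add, Submodule.coe_smul]
    exact plucker_smul_add _ _ _ _ _ _
  have hder : plucker (ℓ (b 0)) (b 1) + plucker (b 0) (ℓ (b 1)) =
      (a₀₀ * a₁₁ - a₀₁ * a₁₀) • (plucker (ℓ (c 0)) (c 1) + plucker (c 0) (ℓ (c 1))) := by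
    rw [h0, h1]
    simp only [map_add, map_smul, Submodule.coe_add, Submodule.coe_smul]
    exact plucker_smul_add_deriv _ _ _ _ _ _ _ _
  rw [hvec, hder]
  refine affineTangent_map (fun ij => C (a₀₀ * a₁₁ - a₀₁ * a₁₀) * X ij) (fun F hF w hw => ?_)
    (fun ij => by simp) h (fun ij => ?_)
  · rw [aeval_eq_eval, eval_bind₁]
    have := hF _ (smul_mem_pluckerCone hw hδ)
    rw [aeval_eq_eval] at this
    convert this using 2
    refine congrArg eval (_root_.funext fun ij => ?_)
    simp
  · change dirDeriv _ _ _ = _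
    rw [dirDeriv_mul, dirDeriv_X, dirDeriv_C]
    simp

/-- A tangent vector to the Plücker cone defines a first order deformation of the line. -/
theorem exists_tangentLift [Infinite K] {r : ProjLine K N} {b : Basis (Fin 2) K r.hat}
    {m : Fin 2 → Fin (N + 1)} {c : Basis (Fin 2) K r.hat}
    (hc : ∀ a i, (c a : Fin (N + 1) → K) i = r.pluckerVec b (m a, i))
    (hcb : r.pluckerVec c = r.pluckerVec b (m 0, m 1) • r.pluckerVec b)
    {w' : Fin (N + 1) × Fin (N + 1) → K}
    (hw' : w' ∈ affineTangent (pluckerCone B) (r.pluckerVec b)) :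
    ∃ ℓ ∈ tangentLifts B r, ∀ a i, ℓ (c a) i = w' (m a, i) := by
  let ℓ : r.hat →ₗ[K] (Fin (N + 1) → K) := c.constr K fun a i => w' (m a, i)
  have hℓ : ∀ a, ℓ (c a) = fun i => w' (m a, i) := fun a => c.constr_basis K _ a
  refine ⟨ℓ, mem_tangentLifts_of_basis c ?_, fun a i => by rw [hℓ]⟩
  rw [hcb, hℓ, hℓ]
  -- On Plücker vectors this quadratic map, the wedge of two rows, is multiplication by the
  -- coordinate `(m 0, m 1)`, so it sends the cone into its closure. Its differential at the vector
  -- of `b` is the derivative required of `ℓ`.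
  refine affineTangent_map
    (fun ij => X (m 0, ij.1) * X (m 1, ij.2) - X (m 0, ij.2) * X (m 1, ij.1)) ?_ ?_ hw' ?_
  · rintro F hF _ ⟨r', hr', b', rfl⟩
    rw [aeval_eq_eval, eval_bind₁]
    have := eval_smul_eq_zero hF ⟨r', hr', b', rfl⟩ (r'.pluckerVec b' (m 0, m 1))
    rw [← plucker_rows] at this
    convert this using 2
    refine congrArg eval (_root_.funext fun ij => ?_)
    simp [plucker]
  · intro ij
    rw [← plucker_rows]
    simp [plucker]
  · intro ij
    change dirDeriv _ _ _ = _
    simp only [dirDeriv_sub, dirDeriv_mul, dirDeriv_X, eval_X, Pi.add_apply, plucker, hc]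
    ring

/-- The derivative of the Plücker vector under a first order deformation determines the deformation
modulo the line. -/
theorem row_sub_mem_hat {r : ProjLine K N} {b : Basis (Fin 2) K r.hat} {m : Fin 2 → Fin (N + 1)}
    {c : Basis (Fin 2) K r.hat}
    (hcm : ∀ a, c a = -((b 1 : Fin (N + 1) → K) (m a)) • b 0 +
      (b 0 : Fin (N + 1) → K) (m a) • b 1)
    (ℓ : r.hat →ₗ[K] (Fin (N + 1) → K)) (a : Fin 2) :
    (fun i => (plucker (ℓ (b 0)) (b 1) + plucker (b 0) (ℓ (b 1))) (m a, i)) - ℓ (c a) ∈ r.hat := by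
  have : (fun i => (plucker (ℓ (b 0)) (b 1) + plucker (b 0) (ℓ (b 1))) (m a, i)) - ℓ (c a) =
      ℓ (b 0) (m a) • (b 1 : Fin (N + 1) → K) - ℓ (b 1) (m a) • (b 0 : Fin (N + 1) → K) := by
    rw [hcm]
    funext i
    simp only [plucker, Pi.add_apply, Pi.sub_apply, map_add, map_smul, Pi.smul_apply, smul_eq_mul]
    ring
  rw [this]
  exact r.hat.sub_mem (r.hat.smul_mem _ (b 1).2) (r.hat.smul_mem _ (b 0).2)

/-- The curve `x + t v` stays in the plane `r̂`, which is part of the cone. -/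
theorem hat_le_affineTangent [Infinite K] {r : ProjLine K N} (hr : r ∈ B) {x : Fin (N + 1) → K}
    (hx : x ∈ r.hat) : r.hat ≤ affineTangent (unionCone B) x := by
  intro v hv
  refine affineTangent_map (C := Set.univ) (fun i => C (x i) + C (v i) * X ()) (fun F hF p _ => ?_)
    (p := fun _ => 0) (v := fun _ => 1) (fun i => by simp) (mem_affineTangent_univ _ _)
    (fun i => ?_)
  · rw [aeval_eq_eval, eval_bind₁]
    have := hF (x + p () • v) ⟨r, hr, r.hat.add_mem hx (r.hat.smul_mem _ hv)⟩
    rw [aeval_eq_eval] at this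
    convert this using 2
    refine congrArg eval (_root_.funext fun i => ?_)
    simp [mul_comm]
  · change dirDeriv _ _ _ = _
    simp [dirDeriv_add, dirDeriv_mul, dirDeriv_C, dirDeriv_X]

theorem sweepDeriv_mem_affineTangent {m : Fin 2 → Fin (N + 1)}
    {p z : Fin 2 ⊕ Fin (N + 1) × Fin (N + 1) → K}
    (hz : z ∈ affineTangent (cylinder (pluckerCone B)) p) :
    sweepDeriv m p z ∈ affineTangent (unionCone B) (sweep m p) := by
  refine affineTangent_map (sweepPoly K m) (fun F hF q hq => ?_) (eval_sweepPoly m p) hz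
    (sum_eval_pderiv_sweepPoly m p z)
  rw [aeval_eq_eval, eval_bind₁]
  simp only [eval_sweepPoly]
  have := hF _ (sweep_mem_unionCone m hq)
  rwa [aeval_eq_eval] at this

theorem inr_mem_affineTangent {p z : Fin 2 ⊕ Fin (N + 1) × Fin (N + 1) → K}
    (hz : z ∈ affineTangent (cylinder (pluckerCone B)) p) :
    (fun ij => z (Sum.inr ij)) ∈ affineTangent (pluckerCone B) fun ij => p (Sum.inr ij) := by
  refine affineTangent_map (fun ij => X (Sum.inr ij)) (fun F hF q hq => ?_) (fun ij => by simp) hz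
    (fun ij => dirDeriv_X _ _ _)
  rw [aeval_eq_eval, eval_bind₁]
  have := hF _ hq
  rw [aeval_eq_eval] at this
  simpa using this

section Frame

variable {r : ProjLine K N} {b : Basis (Fin 2) K r.hat} {m : Fin 2 → Fin (N + 1)}
  {c : Basis (Fin 2) K r.hat}

theorem sweep_elim (hc : ∀ a i, (c a : Fin (N + 1) → K) i = r.pluckerVec b (m a, i))
    (s : Fin 2 → K) :
    sweep m (Sum.elim s (r.pluckerVec b)) = ((∑ a, s a • c a : r.hat) : Fin (N + 1) → K) := by
  rw [Submodule.coe_sum]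
  funext i
  simp [sweep, hc]

theorem sweepDeriv_elim (hc : ∀ a i, (c a : Fin (N + 1) → K) i = r.pluckerVec b (m a, i))
    (s : Fin 2 → K) (z : Fin 2 ⊕ Fin (N + 1) × Fin (N + 1) → K) :
    sweepDeriv m (Sum.elim s (r.pluckerVec b)) z =
      ((∑ a, z (Sum.inl a) • c a : r.hat) : Fin (N + 1) → K) +
        ∑ a, s a • fun i => z (Sum.inr (m a, i)) := by
  rw [Submodule.coe_sum]
  funext i
  simp [sweepDeriv, hc, Finset.sum_add_distrib]

theorem sum_row_sub_mem_hat
    (hcm : ∀ a, c a = -((b 1 : Fin (N + 1) → K) (m a)) • b 0 +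
      (b 0 : Fin (N + 1) → K) (m a) • b 1)
    (ℓ : r.hat →ₗ[K] (Fin (N + 1) → K)) (s : Fin 2 → K) :
    (∑ a, s a • fun i => (plucker (ℓ (b 0)) (b 1) + plucker (b 0) (ℓ (b 1))) (m a, i)) -
      ℓ (∑ a, s a • c a) ∈ r.hat := by
  rw [map_sum, ← Finset.sum_sub_distrib]
  refine r.hat.sum_mem fun a _ => ?_
  rw [map_smul, ← smul_sub]
  exact r.hat.smul_mem _ (row_sub_mem_hat hcm ℓ a)

/-- The values at `x` of the first order deformations of a line in `B` are tangent at `x` to the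
union of the lines. -/
theorem tangentLifts_apply_mem [Infinite K] (hr : r ∈ B)
    (hc : ∀ a i, (c a : Fin (N + 1) → K) i = r.pluckerVec b (m a, i))
    (hcm : ∀ a, c a = -((b 1 : Fin (N + 1) → K) (m a)) • b 0 +
      (b 0 : Fin (N + 1) → K) (m a) • b 1)
    {ℓ : r.hat →ₗ[K] (Fin (N + 1) → K)} (hℓ : ℓ ∈ tangentLifts B r) (x : r.hat) :
    ℓ x ∈ affineTangent (unionCone B) (x : Fin (N + 1) → K) := by
  obtain ⟨s, hx⟩ : ∃ s : Fin 2 → K, ∑ a, s a • c a = x := ⟨c.repr x, c.sum_repr x⟩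
  have hp : Sum.elim s (r.pluckerVec b) ∈ cylinder (pluckerCone B) := ⟨r, hr, b, rfl⟩
  have h1 := sweepDeriv_mem_affineTangent (m := m)
    (elim_mem_affineTangent_cylinder hp (hℓ b) (fun _ => 0))
  rw [sweep_elim hc, sweepDeriv_elim hc, hx] at h1
  have h2 := sum_row_sub_mem_hat hcm ℓ s
  rw [hx] at h2
  have h3 := sub_mem h1 (hat_le_affineTangent hr x.2 h2)
  simpa using h3

/-- Moving `s` only moves the point along the line, so modulo `r̂` the Plücker part of `z` alone
contributes. -/
theorem exists_tangentLift_sub_mem [Infinite K]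
    (hc : ∀ a i, (c a : Fin (N + 1) → K) i = r.pluckerVec b (m a, i))
    (hcb : r.pluckerVec c = r.pluckerVec b (m 0, m 1) • r.pluckerVec b)
    {s : Fin 2 → K} {z : Fin 2 ⊕ Fin (N + 1) × Fin (N + 1) → K}
    (hz : z ∈ affineTangent (cylinder (pluckerCone B)) (Sum.elim s (r.pluckerVec b))) :
    ∃ ℓ ∈ tangentLifts B r,
      sweepDeriv m (Sum.elim s (r.pluckerVec b)) z - ℓ (∑ a, s a • c a) ∈ r.hat := by
  have hw' : (fun ij => z (Sum.inr ij)) ∈ affineTangent (pluckerCone B) (r.pluckerVec b) := by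
    simpa only [Sum.elim_inr] using inr_mem_affineTangent hz
  obtain ⟨ℓ, hℓ, hℓc⟩ := exists_tangentLift hc hcb hw'
  refine ⟨ℓ, hℓ, ?_⟩
  have : ℓ (∑ a, s a • c a) = ∑ a, s a • fun i => z (Sum.inr (m a, i)) := by
    rw [map_sum]
    refine Finset.sum_congr rfl fun a _ => ?_
    rw [map_smul, ← funext (hℓc a)]
  rw [sweepDeriv_elim hc, this, add_sub_cancel_right]
  exact Submodule.coe_mem _

/-- Where the kernel of the sweeping map is spanned by the Euler vector, a deformation with a value
in the line is trivial. -/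
theorem apply_mem_hat_of_euler [Infinite K] (hr : r ∈ B)
    (hc : ∀ a i, (c a : Fin (N + 1) → K) i = r.pluckerVec b (m a, i))
    (hcm : ∀ a, c a = -((b 1 : Fin (N + 1) → K) (m a)) • b 0 +
      (b 0 : Fin (N + 1) → K) (m a) • b 1)
    {s : Fin 2 → K}
    (heuler : ∀ z ∈ affineTangent (cylinder (pluckerCone B)) (Sum.elim s (r.pluckerVec b)),
      sweepDeriv m (Sum.elim s (r.pluckerVec b)) z = 0 →
        ∃ ρ : K, z = ρ • eulerVector (Sum.elim s (r.pluckerVec b)))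
    {ℓ : r.hat →ₗ[K] (Fin (N + 1) → K)} (hℓ : ℓ ∈ tangentLifts B r)
    (hx : ℓ (∑ a, s a • c a) ∈ r.hat) (x : r.hat) : ℓ x ∈ r.hat := by
  have hp : Sum.elim s (r.pluckerVec b) ∈ cylinder (pluckerCone B) := ⟨r, hr, b, rfl⟩
  have h1 := r.hat.add_mem (sum_row_sub_mem_hat hcm ℓ s) hx
  rw [sub_add_cancel] at h1
  set w' := plucker (ℓ (b 0)) (b 1) + plucker (b 0) (ℓ (b 1)) with hw'
  -- The plane component `t` is chosen to cancel the displacement along the line. The resulting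
  -- vector lies in the kernel, hence is a multiple of the Euler vector, and the rows of `w'` are
  -- multiples of the vectors `c a`.
  obtain ⟨t, ht⟩ : ∃ t : Fin 2 → K, ∑ a, t a • c a = -⟨_, h1⟩ := ⟨c.repr _, c.sum_repr _⟩
  obtain ⟨ρ, hρ⟩ := heuler (Sum.elim t w') (elim_mem_affineTangent_cylinder hp (hℓ b) _) (by
    rw [sweepDeriv_elim hc]
    simp only [Sum.elim_inl, Sum.elim_inr, ht]
    exact neg_add_cancel _)
  have hcoef : ∀ a, ℓ (c a) ∈ r.hat := by
    intro a
    have h2 := row_sub_mem_hat hcm ℓ a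
    rw [← hw'] at h2
    have h3 : (fun i => w' (m a, i)) = ρ • (c a : Fin (N + 1) → K) := by
      funext i
      have := congrFun hρ (Sum.inr (m a, i))
      simpa [eulerVector, hc] using this
    rw [h3] at h2
    have h4 := r.hat.sub_mem (r.hat.smul_mem ρ (c a).2) h2
    rwa [sub_sub_cancel] at h4
  rw [← c.sum_repr x, map_sum]
  exact r.hat.sum_mem fun a _ => by
    rw [map_smul]
    exact r.hat.smul_mem _ (hcoef a)

end Frame

theorem finrank_map_mkQ_add {V : Type*} [AddCommGroup V] [Module K V] [FiniteDimensional K V]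
    {P Q : Submodule K V} (h : P ≤ Q) :
    finrank K (Q.map P.mkQ) + finrank K P = finrank K Q := by
  have h1 := (P.mkQ.domRestrict Q).finrank_range_add_finrank_ker
  rw [LinearMap.range_domRestrict] at h1
  have h2 : LinearMap.ker (P.mkQ.domRestrict Q) = P.submoduleOf Q := by
    ext x
    simp [Submodule.submoduleOf]
  rw [h2, (Submodule.submoduleOfEquivOfLe h).finrank_eq] at h1
  exact h1

theorem hat_le_fixedTangent [Infinite K] {r : ProjLine K N} (hr : r ∈ B) :
    r.hat ≤ fixedTangent B r :=
  le_iInf₂ fun _ hx => hat_le_affineTangent hr hx.1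

theorem mem_fixedTangent {r : ProjLine K N} {v : Fin (N + 1) → K} :
    v ∈ fixedTangent B r ↔ ∀ x ∈ r.hat, x ≠ 0 → v ∈ affineTangent (unionCone B) x := by
  simp [fixedTangent, Submodule.mem_iInf]

/-- A vector tangent to a cone at general points of a plane is tangent at all points of the
plane. -/
theorem mem_affineTangent_of_generic [Infinite K] {H : Submodule K (Fin (N + 1) → K)}
    (c : Basis (Fin 2) K H) {C' : Set (Fin (N + 1) → K)} {v : Fin (N + 1) → K}
    {R : MvPolynomial (Fin 2) K} (hR : R ≠ 0)
    (h : ∀ s, eval s R ≠ 0 → v ∈ affineTangent C' ((∑ a, s a • c a : H) : Fin (N + 1) → K))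
    {x : Fin (N + 1) → K} (hx : x ∈ H) : v ∈ affineTangent C' x := by
  intro F hF
  let lin : Fin (N + 1) → MvPolynomial (Fin 2) K := fun i =>
    ∑ a, X a * C ((c a : Fin (N + 1) → K) i)
  let P : MvPolynomial (Fin 2) K := ∑ i, bind₁ lin (pderiv i F) * C (v i)
  have hP : ∀ s, eval s P =
      ∑ i, eval ((∑ a, s a • c a : H) : Fin (N + 1) → K) (pderiv i F) * v i := by
    intro s
    simp only [P, map_sum, map_mul, eval_C, eval_bind₁]
    have : (fun i => eval s (lin i)) = ((∑ a, s a • c a : H) : Fin (N + 1) → K) := by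
      rw [Submodule.coe_sum]
      funext i
      simp [lin]
    rw [this]
  have hRP : R * P = 0 := by
    refine MvPolynomial.funext fun s => ?_
    rw [map_mul, map_zero]
    by_cases hs : eval s R = 0
    · rw [hs, zero_mul]
    · rw [hP, h s hs F hF, mul_zero]
  have h0 := hP (c.repr ⟨x, hx⟩)
  rw [(mul_eq_zero.mp hRP).resolve_left hR, map_zero, c.sum_repr] at h0
  exact h0.symm

end ProjLine

/-! ### The comparison at a general line. -/

namespace ProjLine

theorem mem_tangentSpace {K : Type*} [Field K] {N : ℕ} {B : Set (ProjLine K N)} {r : ProjLine K N}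
    {τ : r.hat →ₗ[K] ((Fin (N + 1) → K) ⧸ r.hat)} :
    τ ∈ tangentSpace B r ↔ ∃ ℓ ∈ tangentLifts B r, r.hat.mkQ ∘ₗ ℓ = τ :=
  Iff.rfl

/-- The point of the plane with coordinates `s` in the basis `c` is not on the line spanned by the
point with coordinates `t`, if a determinant does not vanish. -/
theorem sum_smul_notMem_span {K H : Type*} [Field K] [AddCommGroup H] [Module K H]
    (c : Basis (Fin 2) K H) {s t : Fin 2 → K} (h : s 0 * t 1 - s 1 * t 0 ≠ 0) :
    ∑ a, s a • c a ∉ Submodule.span K {∑ a, t a • c a} := by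
  rintro hmem
  obtain ⟨k, hk⟩ := Submodule.mem_span_singleton.mp hmem
  have hcoord : ∀ a, s a = k * t a := by
    intro a
    have := congrArg (fun x => c.repr x a) hk
    simp only [map_smul, Finsupp.smul_apply, c.repr_sum_self, smul_eq_mul] at this
    exact this.symm
  exact h (by rw [hcoord 0, hcoord 1]; ring)

/-- At a general line of `B`, the tangent space of `B` has the fixed tangent space of the union as
fixed space. -/
theorem isFixedSpace_tangentSpace {K : Type*} [Field K] [Infinite K] {N : ℕ}
    {B : Set (ProjLine K N)} {r : ProjLine K N} (hr : r ∈ B) {b : Basis (Fin 2) K r.hat}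
    {m : Fin 2 → Fin (N + 1)} {c : Basis (Fin 2) K r.hat}
    (hc : ∀ a i, (c a : Fin (N + 1) → K) i = r.pluckerVec b (m a, i))
    (hcm : ∀ a, c a = -((b 1 : Fin (N + 1) → K) (m a)) • b 0 +
      (b 0 : Fin (N + 1) → K) (m a) • b 1)
    (hcb : r.pluckerVec c = r.pluckerVec b (m 0, m 1) • r.pluckerVec b)
    {Q : MvPolynomial (Fin 2 ⊕ Fin (N + 1) × Fin (N + 1)) K}
    (hlift : ∀ s, eval (Sum.elim s (r.pluckerVec b)) Q ≠ 0 →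
      ∀ v ∈ affineTangent (unionCone B) (sweep m (Sum.elim s (r.pluckerVec b))),
        ∃ z ∈ affineTangent (cylinder (pluckerCone B)) (Sum.elim s (r.pluckerVec b)),
          sweepDeriv m (Sum.elim s (r.pluckerVec b)) z = v)
    (heuler : ∀ s, eval (Sum.elim s (r.pluckerVec b)) Q ≠ 0 →
      ∀ z ∈ affineTangent (cylinder (pluckerCone B)) (Sum.elim s (r.pluckerVec b)),
        sweepDeriv m (Sum.elim s (r.pluckerVec b)) z = 0 →
          ∃ ρ : K, z = ρ • eulerVector (Sum.elim s (r.pluckerVec b)))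
    (hne : ∀ s, eval (Sum.elim s (r.pluckerVec b)) Q ≠ 0 → ∑ a, s a • c a ≠ 0)
    {s₀ : Fin 2 → K} (hs₀ : eval (Sum.elim s₀ (r.pluckerVec b)) Q ≠ 0) :
    IsFixedSpace (tangentSpace B r) ((fixedTangent B r).map r.hat.mkQ)
      {x | ∃ s, eval (Sum.elim s (r.pluckerVec b)) Q ≠ 0 ∧ x = ∑ a, s a • c a} where
  exists_eq := by
    rintro _ ⟨s, hs, rfl⟩ _ ⟨v, hv, rfl⟩
    have hv' := mem_fixedTangent.mp hv _ (∑ a, s a • c a : r.hat).2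
      (fun h => hne s hs (Subtype.ext h))
    rw [← sweep_elim hc] at hv'
    obtain ⟨z, hz, hzv⟩ := hlift s hs v hv'
    obtain ⟨ℓ, hℓ, hsub⟩ := exists_tangentLift_sub_mem hc hcb hz
    refine ⟨_, mem_tangentSpace.mpr ⟨ℓ, hℓ, rfl⟩, ?_⟩
    rw [hzv] at hsub
    exact ((Submodule.Quotient.eq _).mpr hsub).symm
  mem := by
    intro x₁ hx₁ y hy
    obtain ⟨v, rfl⟩ := r.hat.mkQ_surjective y
    refine ⟨v, mem_fixedTangent.mpr fun x hx _ => ?_, rfl⟩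
    obtain ⟨t, rfl⟩ : ∃ t : Fin 2 → K, ∑ a, t a • c a = x₁ := ⟨c.repr x₁, c.sum_repr x₁⟩
    -- `R₁` vanishes at the excluded points of the line and `R₂` on the span of `x₁`. Neither is
    -- zero, and tangency outside their zeros implies tangency everywhere.
    let R₁ : MvPolynomial (Fin 2) K := bind₁ (Sum.elim X fun ij => C (r.pluckerVec b ij)) Q
    let R₂ : MvPolynomial (Fin 2) K := X 0 * C (t 1) - X 1 * C (t 0)
    have hR₁ : ∀ s, eval s R₁ = eval (Sum.elim s (r.pluckerVec b)) Q := by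
      intro s
      rw [eval_bind₁]
      refine congrArg (fun p => eval p Q) (_root_.funext fun i => ?_)
      rcases i with a | ij <;> simp
    have hR₂ : ∀ s, eval s R₂ = s 0 * t 1 - s 1 * t 0 := by
      intro s
      simp [R₂]
    have hR : R₁ * R₂ ≠ 0 := by
      refine mul_ne_zero (fun h => hs₀ ?_) (fun h => hx₁ ?_)
      · rw [← hR₁, h, map_zero]
      · have h1 := hR₂ ![1, 0]
        have h0 := hR₂ ![0, 1]
        simp only [h, map_zero, Matrix.cons_val_zero, Matrix.cons_val_one, one_mul, zero_mul,
          sub_zero, zero_sub] at h0 h1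
        rw [Fin.sum_univ_two, ← h1, neg_eq_zero.mp h0.symm, zero_smul, zero_smul, add_zero]
    refine mem_affineTangent_of_generic c hR (fun s hs => ?_) hx
    rw [map_mul, hR₁, hR₂] at hs
    obtain ⟨τ, hτ, hτv⟩ := hy _ ⟨s, left_ne_zero_of_mul hs, rfl⟩
      (sum_smul_notMem_span c (right_ne_zero_of_mul hs))
    obtain ⟨ℓ, hℓ, rfl⟩ := mem_tangentSpace.mp hτ
    have hsub : ℓ (∑ a, s a • c a) - v ∈ r.hat := (Submodule.Quotient.eq _).mp hτv
    have h := sub_mem (tangentLifts_apply_mem hr hc hcm hℓ (∑ a, s a • c a))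
      (hat_le_affineTangent hr (∑ a, s a • c a : r.hat).2 hsub)
    rwa [sub_sub_cancel] at h
  eq_zero := by
    rintro _ ⟨s, hs, rfl⟩ τ hτ h0
    obtain ⟨ℓ, hℓ, rfl⟩ := mem_tangentSpace.mp hτ
    ext1 x
    exact (Submodule.Quotient.mk_eq_zero _).mpr (apply_mem_hat_of_euler hr hc hcm (heuler s hs) hℓ
      ((Submodule.Quotient.mk_eq_zero _).mp h0) x)

/-- At a general line `r` of `B`, the length of the focal locus determines the dimension of the
fixed tangent space. -/
theorem exists_isOpen_hasFocalLength_iff {K : Type u} [Field K] [IsAlgClosed K] [CharZero K]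
    {N n : ℕ} {B : Set (ProjLine K N)} (hB : IsIrreducible B)
    (hn : HasProjectiveDim K (pluckerCone B) n)
    (hX : HasProjectiveDim K (unionCone B) (n + 1)) :
    ∃ U : Set (ProjLine K N), IsOpen U ∧ (B ∩ U).Nonempty ∧ ∀ r ∈ U, r ∈ B → ∀ k,
      HasFocalLength B r k ↔ finrank K (fixedTangent B r) = k + 2 := by
  have hprime := isPrime_vanishingIdeal_pluckerCone hB
  obtain ⟨E, _, _, y, hy, _, htr⟩ := exists_genericCoordinates_cylinder (pluckerCone B) hprime
  obtain ⟨r₀, hr₀⟩ := hB.1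
  have b₀ : Basis (Fin 2) K r₀.hat := finBasisOfFinrankEq K _ r₀.finrank_hat
  obtain ⟨⟨i₀, j₀⟩, hij⟩ := Function.ne_iff.mp (r₀.pluckerVec_ne_zero b₀)
  let m : Fin 2 → Fin (N + 1) := ![i₀, j₀]
  have hm : ∃ w ∈ pluckerCone B, w (m 0, m 1) ≠ 0 := ⟨_, ⟨r₀, hr₀, b₀, rfl⟩, hij⟩
  obtain ⟨Q₁, hQ₁, hlift⟩ := exists_sweepDeriv_eq hy hprime hm
  obtain ⟨Q₂, hQ₂, heuler⟩ := exists_eq_smul_eulerVector hy hprime hm hX (htr.trans (by rw [hn]))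
  have hinl : aeval y (X (Sum.inl 0) : MvPolynomial (Fin 2 ⊕ Fin (N + 1) × Fin (N + 1)) K) ≠ 0 := by
    intro h
    have := (hy.aeval_eq_zero_iff _).mp h (Sum.elim (fun _ => 1) (r₀.pluckerVec b₀))
      ⟨r₀, hr₀, b₀, rfl⟩
    simp at this
  have hinr : aeval y (X (Sum.inr (m 0, m 1)) :
      MvPolynomial (Fin 2 ⊕ Fin (N + 1) × Fin (N + 1)) K) ≠ 0 := by
    intro h
    have := (hy.aeval_eq_zero_iff _).mp h (Sum.elim (fun _ => 1) (r₀.pluckerVec b₀))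
      ⟨r₀, hr₀, b₀, rfl⟩
    rw [eval_X] at this
    exact hij this
  -- The first variable keeps the swept point nonzero; the second makes the two rows a basis of the
  -- line.
  let Q := Q₁ * Q₂ * X (Sum.inl 0) * X (Sum.inr (m 0, m 1))
  have hQ : aeval y Q ≠ 0 := by
    simp only [Q, map_mul]
    exact mul_ne_zero (mul_ne_zero (mul_ne_zero hQ₁ hQ₂) hinl) hinr
  have hfactors : ∀ p, eval p Q ≠ 0 →
      eval p Q₁ ≠ 0 ∧ eval p Q₂ ≠ 0 ∧ p (Sum.inl 0) ≠ 0 ∧ p (Sum.inr (m 0, m 1)) ≠ 0 := by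
    intro p hp
    simp only [Q, map_mul, eval_X, mul_ne_zero_iff] at hp
    tauto
  obtain ⟨p₀, hp₀, hp₀Q⟩ : ∃ p ∈ cylinder (pluckerCone B), eval p Q ≠ 0 := by
    by_contra! h
    exact hQ ((hy.aeval_eq_zero_iff _).mpr h)
  -- Freezing `s₀` turns the condition on `p` into one on the Plücker vector alone, and so into an
  -- open condition on the line.
  let s₀ : Fin 2 → K := fun a => p₀ (Sum.inl a)
  let F : MvPolynomial (Fin (N + 1) × Fin (N + 1)) K := bind₁ (Sum.elim (fun a => C (s₀ a)) X) Q
  have hF : ∀ w, eval w F = eval (Sum.elim s₀ w) Q := by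
    intro w
    rw [eval_bind₁]
    refine congrArg (fun p => eval p Q) (_root_.funext fun i => ?_)
    rcases i with a | ij <;> simp
  obtain ⟨U, hU, hBU, hUF⟩ := exists_isOpen_of_eval_ne_zero (F := F) hp₀ (by
    rwa [hF, show Sum.elim s₀ (fun ij => p₀ (Sum.inr ij)) = p₀ from Sum.elim_comp_inl_inr p₀])
  refine ⟨U, hU, hBU, fun r hrU hr k => ?_⟩
  have b₁ : Basis (Fin 2) K r.hat := finBasisOfFinrankEq K _ r.finrank_hat
  -- `F` is not homogeneous, so a basis is chosen whose Plücker vector is a multiple at which `F`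
  -- does not vanish.
  obtain ⟨ρ, hρ, hρF⟩ := exists_ne_zero_eval_ne_zero (hUF r hrU b₁)
  obtain ⟨b, hb⟩ := r.exists_basis_smul b₁ hρ
  rw [eval_scalingPolynomial, ← hb, hF] at hρF
  obtain ⟨c, hc, hcm, hcb⟩ := r.exists_rowBasis b m (hfactors _ hρF).2.2.2
  have hmem : ∀ s, Sum.elim s (r.pluckerVec b) ∈ cylinder (pluckerCone B) :=
    fun s => ⟨r, hr, b, rfl⟩
  have hne : ∀ s, eval (Sum.elim s (r.pluckerVec b)) Q ≠ 0 → ∑ a, s a • c a ≠ 0 := by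
    intro s hs h
    exact (hfactors _ hs).2.2.1 (Fintype.linearIndependent_iff.mp c.linearIndependent s h 0)
  have hfix := isFixedSpace_tangentSpace hr hc hcm hcb
    (fun s hs => hlift _ (hmem s) (hfactors _ hs).1)
    (fun s hs => heuler _ (hmem s) (hfactors _ hs).2.1) hne hρF
  rw [hasFocalLength_iff hfix ⟨s₀, hρF, rfl⟩ (hne _ hρF),
    ← finrank_map_mkQ_add (hat_le_fixedTangent hr), r.finrank_hat]
  exact Nat.add_right_cancel_iff.symm

/-- Any open set witnessing one property meets `U` inside the irreducible `B`, and the intersection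
witnesses the other. -/
theorem ForGeneral.congr {K : Type*} [Field K] {N : ℕ} {B : Set (ProjLine K N)}
    (hB : IsIrreducible B) {P P' : ProjLine K N → Prop} {U : Set (ProjLine K N)} (hU : IsOpen U)
    (hBU : (B ∩ U).Nonempty) (h : ∀ r ∈ U, r ∈ B → (P r ↔ P' r)) :
    ForGeneral B P ↔ ForGeneral B P' := by
  have key : ∀ P P' : ProjLine K N → Prop, (∀ r ∈ U, r ∈ B → P r → P' r) →
      ForGeneral B P → ForGeneral B P' := by
    rintro P P' h ⟨V, hV, hVB, hP⟩
    obtain ⟨r, hr, hrUV⟩ := hB.2 U V hU hV hBU (Set.inter_comm V B ▸ hVB)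
    exact ⟨U ∩ V, hU.inter hV, ⟨r, hrUV, hr⟩, fun r hr => h r hr.1.1 hr.2 (hP r ⟨hr.1.2, hr.2⟩)⟩
  exact ⟨key P P' fun r hrU hr => (h r hrU hr).mp, key P' P fun r hrU hr => (h r hrU hr).mpr⟩

end ProjLine

end

theorem theorem0p1 {K : Type*} [Field K] [IsAlgClosed K] [CharZero K] (N n : ℕ) (hn : n + 2 ≤ N)
    (B : Set (ProjLine K N)) (hB_closed : IsClosed B) (hB_irred : IsIrreducible B)
    (hB_dim : HasProjectiveDim K (ProjLine.pluckerCone B) n)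
    (hX_dim : HasProjectiveDim K (ProjLine.unionCone B) (n + 1))
    (k : ℕ) (hk : k ≤ n) :
    ProjLine.ForGeneral B (fun r => ProjLine.HasFocalLength B r k) ↔
      ProjLine.ForGeneral B
        (fun r => Module.finrank K (ProjLine.fixedTangent B r) = k + 2) := by
  obtain ⟨U, hU, hBU, h⟩ := ProjLine.exists_isOpen_hasFocalLength_iff hB_irred hB_dim hX_dim
  exact ProjLine.ForGeneral.congr hB_irred hU hBU fun r hrU hr => h r hrU hr k
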